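/- **Setting.** Let $M$ be a connected oriented 3-manifold with a (finite, transverse taut) veering triangulation $\tau$: an ideal triangulation whose faces are cooriented so that two faces of each tetrahedron point into it (its bottom faces) and two point out of it (its top faces), such that, if an edge of a tetrahedron gets the angle $\pi$ or $0$ according to whether the coorientations of its two faces in this tetrahedron agree or disagree, the sum of the angles around each edge is $2\pi$; moreover each edge is labelled right or left veering so that each tetrahedron is orientation-preservingly isomorphic to a thickened rhombus in $\mathbb R^2\times\mathbb R$ whose vertical diagonal (the top edge, of angle $\pi$) lies above its horizontal diagonal (the bottom edge, of angle $\pi$), and whose sides (of angle $0$) are right veering if their slope is positive and left veering if it is negative. Let $E$, $F$, $T$ be the sets of edges, faces and tetrahedra of $\tau$; the bottom edge defines a bijection $T\to E$, and each face is a bottom face of a unique tetrahedron. Let $G=H_1(M)/\text{torsion}$, and let $\widetilde M$ be the universal free abelian cover of $M$, with deck group $G$. Choose lifts of the simplices of $\tau$ to $\widetilde M$, so that the free abelian groups on the edges and faces of the lifted triangulation are $\mathbb Z[G]^E$ and $\mathbb Z[G]^F$. * Let $L\colon\mathbb Z[G]^E\to\mathbb Z[G]^E$ send the bottom edge $\mathbf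 b$ of each lifted tetrahedron to $\mathbf b-(\mathbf t+\mathbf s_1+\mathbf s_2)$, where $\mathbf t$ is its top edge and $\mathbf s_1,\mathbf s_2$ are its two sides whose veer is opposite to that of $\mathbf t$. The veering polynomial is $V_\tau=\det L\in\mathbb Z[G]$. * Let $L^\triangle\colon\mathbb Z[G]^F\to\mathbb Z[G]^E$ send each lifted face $f$ to $\mathbf b-(\mathbf x+\mathbf y)$, where $\mathbf b$ is the bottom edge of the tetrahedron of which $f$ is a bottom face and $\mathbf x,\mathbf y$ are the other edges of $f$. The taut polynomial $\Theta_\tau$, defined up to a unit, is a greatest common divisor of the elements of the ideal generated by the $|E|\times|E|$ minors of $L^\triangle$. * Let $A\colon F\to F$ be the permutation which sends a bottom face $f$ of a tetrahedron $t$ to the top face of $t$ that meets $f$ within $t$ along the edge with the same veer as the top edge of $t$; it lifts to $A\colon\mathbb Z[G]^F\to\mathbb Z[G]^F$. The AB polynomial is $V^{\mathcal{AB}}=\det(I+A)\in\mathbb Z[G]$. The AB-cycles $c_1,\dots,c_n$ are the cycles of the permutation $A$ of $F$; $k_i$ is the length of $c_i$, and $g_i\in G$ is the class of the closed path in $M$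 which passes positively through the faces of $c_i$ in their order. **Theorem.** The greatest common divisor $\Theta_\tau$ exists, and up to multiplication by a unit $\pm g\in\mathbb Z[G]$, $g\in G$, $$V^{\mathcal{AB}}=\prod_{i=1}^n\bigl(1+(-1)^{k_i+1}g_i\bigr).$$ If $\operatorname{rank}H_1(M)>1$, then, up to multiplication by a unit $\pm g\in\mathbb Z[G]$, $$V_\tau=V^{\mathcal{AB}}\cdot\Theta_\tau .$$ If $\operatorname{rank}H_1(M)=1$ and $t$ generates $G$, then, up to multiplication by a unit $\pm g\in\mathbb Z[G]$, $V^{\mathcal{AB}}\cdot\Theta_\tau$ is equal to $V_\tau$, to $(1+t)V_\tau$ or to $(1-t)V_\tau$. -/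

import Mathlib

/-- An edge of a tetrahedron with vertex set `Fin 4`: an unordered pair of distinct vertices. -/
abbrev TetEdge : Type := {c : Sym2 (Fin 4) // ¬ c.IsDiag}

namespace TetEdge

/-- The image of an edge under a relabelling of the vertices. -/
def map (σ : Equiv.Perm (Fin 4)) (c : TetEdge) : TetEdge :=
  ⟨c.1.map σ, fun h => c.2 ((Sym2.isDiag_map σ.injective).1 h)⟩

end TetEdge

/-- A (connected, oriented) ideal triangulation with set of tetrahedra `T`.  Each tetrahedron has
vertex set `Fin 4`, the order `0, 1, 2, 3` of the vertices being positive for the orientation; its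
`i`-th face is the face opposite to the vertex `i`.  The `i`-th face of `t` is glued to the face
number `glue t i i` of the tetrahedron `adj t i`, a vertex `j ≠ i` of that face being glued to
the vertex `glue t i j`.  All gluings are compatible with the orientations.  The manifold is the
union of the tetrahedra with their vertices removed. -/
structure IdealTriangulation (T : Type*) where
  adj : T → Fin 4 → T
  glue : T → Fin 4 → Equiv.Perm (Fin 4)
  adj_adj : ∀ t i, adj (adj t i) (glue t i i) = t
  glue_glue : ∀ t i, glue (adj t i) (glue t i i) = (glue t i)⁻¹
  orientation : ∀ t i, Equiv.Perm.sign (glue t i) = -1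
  connected : ∀ t t', Relation.ReflTransGen (fun a b => ∃ i, adj a i = b) t t'

namespace IdealTriangulation

variable {T : Type*} (τ : IdealTriangulation T)

/-- Two edges of tetrahedra that are identified by the gluing of a face which contains them. -/
def EdgeGlued (x y : T × TetEdge) : Prop :=
  ∃ i, i ∉ x.2.1 ∧ y = (τ.adj x.1 i, x.2.map (τ.glue x.1 i))

/-- The set `E` of edges of the triangulation. -/
def Edge : Type _ := Quot τ.EdgeGlued

/-- The edge of the triangulation given by the edge `c` of the tetrahedron `t`. -/
def edge (t : T) (c : TetEdge) : τ.Edge := Quot.mk _ (t, c)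

end IdealTriangulation

/-- The two veers of an edge. -/
inductive Veer
  | left
  | right

namespace ModelTet

/-! The model veering tetrahedron is a thickened rhombus, seen from above.  The vertices
`0, 1, 2, 3` are the west, east, north and south corner.  The horizontal diagonal `{0, 1}` is the
bottom edge and the vertical diagonal `{2, 3}` lies above it and is the top edge; these two edges
have angle `π`, the four sides have angle `0`.  The two faces which contain the bottom edge are
the bottom faces, and the two others the top faces. -/

/-- The bottom edge. -/
def bot : TetEdge := ⟨s(0, 1), by decide⟩
/-- The top edge. -/
def top : TetEdge := ⟨s(2, 3), by decide⟩
/-- The north-west side, of positive slope. -/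
def nw : TetEdge := ⟨s(0, 2), by decide⟩
/-- The south-east side, of positive slope. -/
def se : TetEdge := ⟨s(1, 3), by decide⟩
/-- The south-west side, of negative slope. -/
def sw : TetEdge := ⟨s(0, 3), by decide⟩
/-- The north-east side, of negative slope. -/
def ne : TetEdge := ⟨s(1, 2), by decide⟩

/-- The faces opposite to the vertices `2` and `3` are the bottom faces: they are cooriented into
the tetrahedron.  The faces opposite to `0` and `1` are cooriented out of it. -/
def IsBottomFace (i : Fin 4) : Prop := i = 2 ∨ i = 3

end ModelTet

open ModelTet in
/-- A veering triangulation: each tetrahedron is identified with the model veering tetrahedron by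
an orientation preserving isomorphism, so that coorientations of faces agree (a top face is glued
to a bottom face), the sum of the angles around each edge is `2π`, and each edge has a veer which
is right for the sides of positive slope and left for the sides of negative slope in every
tetrahedron. -/
structure VeeringTriangulation (T : Type*) extends IdealTriangulation T where
  coorientation : ∀ t i, IsBottomFace (glue t i i) ↔ ¬ IsBottomFace i
  angle_sum : ∀ e : toIdealTriangulation.Edge,
    Nat.card {x : T × TetEdge //
      toIdealTriangulation.edge x.1 x.2 = e ∧ (x.2 = bot ∨ x.2 = top)} = 2
  veer : toIdealTriangulation.Edge → Veer
  veer_nw : ∀ t, veer (toIdealTriangulation.edge t nw) = Veer.right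
  veer_se : ∀ t, veer (toIdealTriangulation.edge t se) = Veer.right
  veer_sw : ∀ t, veer (toIdealTriangulation.edge t sw) = Veer.left
  veer_ne : ∀ t, veer (toIdealTriangulation.edge t ne) = Veer.left

namespace VeeringTriangulation

open ModelTet

variable {T : Type*} (τ : VeeringTriangulation T)

/-- The set `F` of faces of the triangulation.  A face is recorded as a bottom face of the unique
tetrahedron above it. -/
@[ext]
structure Face (τ : VeeringTriangulation T) where
  above : T
  idx : Fin 4
  isBottom : IsBottomFace idx

/-- The tetrahedron below a face. -/
def Face.below {τ : VeeringTriangulation T} (f : τ.Face) : T := τ.adj f.above f.idx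

noncomputable instance [Finite T] : Fintype τ.Face :=
  @Fintype.ofFinite _ (Finite.of_injective (fun f : τ.Face => (f.above, f.idx))
    (fun _ _ h => Face.ext (congrArg Prod.fst h) (congrArg Prod.snd h)))

noncomputable instance [Finite T] : Fintype τ.Edge :=
  @Fintype.ofFinite _ (inferInstanceAs (Finite (Quot τ.EdgeGlued)))

/-! ### First homology

The manifold deformation retracts to the 2-skeleton of the dual complex, the polygon dual to an edge
of the triangulation being subdivided into triangles from its centre.  This complex has
* a vertex for each tetrahedron and a vertex for each edge of the triangulation (the centre of
  the dual polygon);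
* a 1-cell for each face `f`, dual to it, from the tetrahedron below `f` to the one above `f`, and a
  1-cell for each edge `c` of a tetrahedron `t`, from `t` to the edge which `c` represents;
* a triangle for each face `f` and each edge `c` of `f`. -/

/-- The 1-cells. -/
abbrev Cell1 : Type _ := τ.Face ⊕ (T × TetEdge)

/-- The triangles. -/
abbrev Cell2 : Type _ := {x : τ.Face × TetEdge // x.1.idx ∉ x.2.1}

/-- The boundary of 1-chains. -/
noncomputable def boundary1 : (τ.Cell1 →₀ ℤ) →ₗ[ℤ] ((T ⊕ τ.Edge) →₀ ℤ) :=
  Finsupp.linearCombination ℤ fun x => match x with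
    | Sum.inl f => Finsupp.single (Sum.inl f.above) 1 - Finsupp.single (Sum.inl f.below) 1
    | Sum.inr x =>
        Finsupp.single (Sum.inr (τ.edge x.1 x.2)) 1 - Finsupp.single (Sum.inl x.1) 1

/-- The boundary of 2-chains. -/
noncomputable def boundary2 : (τ.Cell2 →₀ ℤ) →ₗ[ℤ] (τ.Cell1 →₀ ℤ) :=
  Finsupp.linearCombination ℤ fun x =>
    Finsupp.single (Sum.inl x.1.1) 1 + Finsupp.single (Sum.inr (x.1.1.above, x.1.2)) 1
      - Finsupp.single (Sum.inr (x.1.1.below, x.1.2.map (τ.glue x.1.1.above x.1.1.idx))) 1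

/-- The 1-cycles. -/
noncomputable abbrev Z1 : Submodule ℤ (τ.Cell1 →₀ ℤ) := LinearMap.ker τ.boundary1

/-- The first homology group `H₁(M)`. -/
abbrev H1 : Type _ := τ.Z1 ⧸ (LinearMap.range τ.boundary2).comap τ.Z1.subtype

/-- The group `G = H₁(M)/torsion`, written additively. -/
abbrev G : Type _ := τ.H1 ⧸ Submodule.torsion ℤ τ.H1

/-- The class in `G` of a 1-cycle. -/
noncomputable def cls : τ.Z1 →ₗ[ℤ] τ.G :=
  (Submodule.torsion ℤ τ.H1).mkQ ∘ₗ ((LinearMap.range τ.boundary2).comap τ.Z1.subtype).mkQ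

/-! ### Lifts to the universal free abelian cover -/

/-- A choice of lifts to the universal free abelian cover of all vertices of the above complex,
that is, of all tetrahedra and edges of the triangulation, recorded by the translations of the
1-cells: if `x` is a 1-cell from `v` to `w`, then the lift of `x` which starts at the chosen lift of
`v` ends at the translate by `shift x` of the chosen lift of `w`.  So the translation of a cycle
is its class in `G`. -/
structure Lift where
  shift : (τ.Cell1 →₀ ℤ) →ₗ[ℤ] τ.G
  shift_cycle : ∀ z : τ.Z1, shift z = τ.cls z

/-- Lifts exist. -/
theorem nonempty_lift [Finite T] : Nonempty τ.Lift := by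
  have hE : Finite τ.Edge := inferInstanceAs (Finite (Quot τ.EdgeGlued))
  have hfree : Module.Free ℤ (LinearMap.range τ.boundary1) :=
    Module.free_of_finite_type_torsion_free'
  obtain ⟨g, hg⟩ := Module.projective_lifting_property τ.boundary1.rangeRestrict
    LinearMap.id τ.boundary1.surjective_rangeRestrict
  have hb : ∀ y, τ.boundary1 (g y) = y := fun y =>
    congrArg Subtype.val (LinearMap.congr_fun hg y)
  let r : (τ.Cell1 →₀ ℤ) →ₗ[ℤ] (τ.Cell1 →₀ ℤ) := LinearMap.id - g ∘ₗ τ.boundary1.rangeRestrict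
  have hr : ∀ x, r x ∈ τ.Z1 := by
    intro x
    change τ.boundary1 (x - g (τ.boundary1.rangeRestrict x)) = 0
    rw [map_sub, hb]
    exact sub_self _
  have hrz : ∀ z : τ.Z1, r z = z := by
    intro z
    have hz : τ.boundary1.rangeRestrict z = 0 := Subtype.ext z.2
    change (z : τ.Cell1 →₀ ℤ) - g (τ.boundary1.rangeRestrict z) = z
    rw [hz, map_zero, sub_zero]
  exact ⟨⟨τ.cls ∘ₗ LinearMap.codRestrict τ.Z1 r hr, fun z =>
    congrArg τ.cls (Subtype.ext (hrz z) : LinearMap.codRestrict τ.Z1 r hr z = z)⟩⟩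

/-- The group ring `ℤ[G]`. -/
abbrev GroupRing : Type _ := AddMonoidAlgebra ℤ τ.G

/-- The element `g` of the group ring. -/
noncomputable def mon (g : τ.G) : τ.GroupRing := AddMonoidAlgebra.single g 1

/-- Equality up to a unit `±g` of the group ring. -/
def EqUpToUnit (p q : τ.GroupRing) : Prop :=
  ∃ (ε : ℤˣ) (g : τ.G), p = AddMonoidAlgebra.single g (ε : ℤ) * q

namespace Lift

variable {τ} (s : τ.Lift)

/-- The translation along the 1-cell dual to a face: the tetrahedron above `f` that is adjacent to
the chosen lift of the tetrahedron below `f` is the translate by this element of the chosen lift. -/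
noncomputable def face (f : τ.Face) : τ.G := s.shift (Finsupp.single (Sum.inl f) 1)

/-- The edge `c` of the chosen lift of `t` is the translate by this element of the chosen lift of
the edge of the triangulation which `c` represents. -/
noncomputable def corner (t : T) (c : TetEdge) : τ.G := s.shift (Finsupp.single (Sum.inr (t, c)) 1)

end Lift

/-! ### The veering polynomial -/

/-- The two sides of `t` with a given veer. -/
def sides : Veer → Finset TetEdge
  | Veer.right => {nw, se}
  | Veer.left => {sw, ne}

/-- The opposite veer. -/
def _root_.Veer.opp : Veer → Veer
  | Veer.right => Veer.left
  | Veer.left => Veer.right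

open Classical in
/-- The tetrahedron relation `b - (t + s₁ + s₂)`, as an element of `ℤ[G]^E`, of the tetrahedron above
the chosen lift of the bottom edge of `t`; here `s₁, s₂` are the sides of `t` whose veer is opposite
to the veer of the top edge. -/
noncomputable def tetRel (s : τ.Lift) (t : T) : τ.Edge → τ.GroupRing :=
  Pi.single (τ.edge t bot) 1
    - ∑ c ∈ insert top (sides (τ.veer (τ.edge t top)).opp),
        Pi.single (τ.edge t c) (τ.mon (s.corner t c - s.corner t bot))

/-- The matrix of `L : ℤ[G]^E → ℤ[G]^E`, where `E` is identified with `T` by the bijection which sends a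
tetrahedron to its bottom edge. -/
noncomputable def matL (s : τ.Lift) : Matrix T T τ.GroupRing :=
  Matrix.of fun t' t => τ.tetRel s t (τ.edge t' bot)

open Classical in
/-- The veering polynomial. -/
noncomputable def veeringPolynomial [Fintype T] (s : τ.Lift) : τ.GroupRing := (τ.matL s).det

/-! ### The taut polynomial -/

open Classical in
/-- The face relation `b - (x + y)` of the face `f`, as an element of `ℤ[G]^E`.  The lift of `f` is the
one which is a bottom face of the chosen lift of the tetrahedron above `f`. -/
noncomputable def faceRel (s : τ.Lift) (f : τ.Face) : τ.Edge → τ.GroupRing :=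
  Pi.single (τ.edge f.above bot) (τ.mon (s.corner f.above bot))
    - ∑ c : TetEdge with f.idx ∉ c.1 ∧ c ≠ bot,
        Pi.single (τ.edge f.above c) (τ.mon (s.corner f.above c))

/-- The matrix of `L^△ : ℤ[G]^F → ℤ[G]^E`. -/
noncomputable def matLTriangle (s : τ.Lift) : Matrix τ.Edge τ.Face τ.GroupRing :=
  Matrix.of fun e f => τ.faceRel s f e

open Classical in
/-- The Fitting ideal of the face module, generated by the minors of `L^△` of size `|E|`. -/
noncomputable def fittingIdeal [Finite T] (s : τ.Lift) : Ideal τ.GroupRing :=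
  Ideal.span (Set.range fun k : τ.Edge → τ.Face => ((τ.matLTriangle s).submatrix id k).det)

/-- `Θ` is a taut polynomial: a greatest common divisor of the elements of the Fitting ideal. -/
def IsTautPolynomial [Finite T] (s : τ.Lift) (Θ : τ.GroupRing) : Prop :=
  ∀ d : τ.GroupRing, d ∣ Θ ↔ ∀ p ∈ τ.fittingIdeal s, d ∣ p

/-! ### AB-cycles and the AB polynomial -/

/-- The edge which the bottom face opposite to `i = 2, 3` and the top face opposite to the vertex
`1` have in common. -/
def commonEdge (i : Fin 4) : TetEdge := if i = 3 then nw else sw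

open Classical in
/-- For a bottom face `f` of `t`, the (number of the) top face of `t` which meets `f` along the edge
with the same veer as the top edge of `t`.  Of the two edges of `f` other than the bottom edge one is
right and one is left, and the top faces opposite to `1` and `0` each meet `f` along one of them. -/
noncomputable def exitFace (f : τ.Face) : Fin 4 :=
  if τ.veer (τ.edge f.above (commonEdge f.idx)) = τ.veer (τ.edge f.above top) then 1 else 0

theorem exitFace_not_bottom (f : τ.Face) : ¬ IsBottomFace (τ.exitFace f) := by
  unfold exitFace IsBottomFace
  split_ifs <;> decide

/-- The map `A : F → F`. -/
noncomputable def abNext (f : τ.Face) : τ.Face where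
  above := τ.adj f.above (τ.exitFace f)
  idx := τ.glue f.above (τ.exitFace f) (τ.exitFace f)
  isBottom := (τ.coorientation _ _).2 (τ.exitFace_not_bottom f)

theorem below_abNext (f : τ.Face) : (τ.abNext f).below = f.above := τ.adj_adj _ _

theorem abNext_injective : Function.Injective τ.abNext := by
  intro f f' h
  have ht : f.above = f'.above := by rw [← below_abNext, ← below_abNext, h]
  have hx : ∀ f : τ.Face,
      τ.exitFace f = τ.glue (τ.abNext f).above (τ.abNext f).idx (τ.abNext f).idx := by
    intro f
    simp [abNext, τ.glue_glue]
  have he : τ.exitFace f = τ.exitFace f' := by rw [hx f, hx f', h]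
  obtain ⟨t, i, hi⟩ := f
  obtain ⟨t', i', hi'⟩ := f'
  obtain rfl : t = t' := ht
  rcases hi with rfl | rfl <;> rcases hi' with rfl | rfl <;>
    first
    | rfl
    | (exfalso
       cases h : τ.veer (τ.edge t top) <;>
         simp [exitFace, commonEdge, τ.veer_nw, τ.veer_sw, h] at he)

/-- The map `A` as a permutation of the set of faces. -/
noncomputable def abPerm [Finite T] : Equiv.Perm τ.Face :=
  Equiv.ofBijective τ.abNext (Finite.injective_iff_bijective.1 τ.abNext_injective)

/-- The AB-cycles: the cycles of the permutation `A`, including its fixed points. -/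
abbrev ABCycle [Finite T] : Type _ := Quotient (Equiv.Perm.SameCycle.setoid τ.abPerm)

noncomputable instance [Finite T] : Fintype τ.ABCycle := Fintype.ofFinite _

open Classical in
/-- The faces through which an AB-cycle passes. -/
noncomputable def abFaces [Finite T] (c : τ.ABCycle) : Finset τ.Face :=
  {f : τ.Face | (Quotient.mk _ f : τ.ABCycle) = c}

/-- The 1-chain of an AB-cycle, in the dual graph. -/
noncomputable def abChain [Finite T] (c : τ.ABCycle) : τ.Cell1 →₀ ℤ :=
  ∑ f ∈ τ.abFaces c, Finsupp.single (Sum.inl f) 1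

theorem abChain_mem [Finite T] (c : τ.ABCycle) : τ.abChain c ∈ τ.Z1 := by
  have hA : ∀ f, τ.abPerm f ∈ τ.abFaces c ↔ f ∈ τ.abFaces c := by
    intro f
    have : (Quotient.mk _ (τ.abPerm f) : τ.ABCycle) = Quotient.mk _ f :=
      Quotient.sound (Equiv.Perm.sameCycle_apply_left.2 (Equiv.Perm.SameCycle.refl _ _))
    simp [abFaces, this]
  rw [LinearMap.mem_ker, abChain, map_sum]
  simp only [boundary1, Finsupp.linearCombination_single, one_smul, Finset.sum_sub_distrib]
  rw [sub_eq_zero]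
  refine Finset.sum_equiv τ.abPerm (fun f => (hA f).symm) (fun f _ => ?_)
  have : (τ.abPerm f).below = f.above := τ.below_abNext f
  rw [this]

/-- The class in `G` of an AB-cycle. -/
noncomputable def abClass [Finite T] (c : τ.ABCycle) : τ.G := τ.cls ⟨τ.abChain c, τ.abChain_mem c⟩

/-- The length of an AB-cycle. -/
noncomputable def abLength [Finite T] (c : τ.ABCycle) : ℕ := (τ.abFaces c).card

open Classical in
/-- The matrix of `L^AB = I + A : ℤ[G]^F → ℤ[G]^F`, where `A` is lifted to the cover.  The lift of `f`
is the one which is a bottom face of the chosen lift of the tetrahedron above `f`, and it is sent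
to the translate by `s.face (A f)` of the lift of `A f`. -/
noncomputable def matLAB (s : τ.Lift) : Matrix τ.Face τ.Face τ.GroupRing :=
  1 + Matrix.of fun f' f => if f' = τ.abNext f then τ.mon (s.face f') else 0

open Classical in
/-- The AB polynomial. -/
noncomputable def abPolynomial [Finite T] (s : τ.Lift) : τ.GroupRing := (τ.matLAB s).det

end VeeringTriangulation

/-! The heart is a factorization: up to translations by elements of `G`, `L^△ ∘ (I + A)` sends each
face to the relation of the tetrahedron above it. Indeed the relations of a bottom face `f` of `t`
and of `A f` contain their common edge, which has the veer of the top edge of `t`, with opposite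
signs, and what remains is the relation of `t` (`Lift.faceRel_add_faceRel_abNext`). So the two
bottom faces of a tetrahedron give equal columns of `L^△ (I + A)`. A unimodular column operation
turns this product into `[L | 0]`, up to units in the columns, and turns the right half of `I + A`
into `diffMat`. Comparing complementary minors gives, up to units, (minor of `L^△`) · `V^AB` = `V` ·
(complementary minor of `diffMat`), which is `associated_minor_mul_abPolynomial`. As `ℤ[G]` is
factorial, `V^AB · Θ = V · c`, where `c` divides all maximal minors of `diffMat` if `V ≠ 0`.

It remains to bound `c`. The matrix `diffMat` is a signed incidence matrix of the dual graph,
twisted by the translations along the faces (`diffMat_row`). Since its maximal minors vanish modulo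
`c` and the dual graph is connected, these translations are, up to sign, the coboundary of a
function on the tetrahedra modulo `c`. Hence every `g` in `G` becomes `±1` modulo `c`
(`exists_map_mon_eq_sign`). In rank at least two this forces `c` to be a unit; in rank one `c`
divides `t - 1` or `t + 1`, whose only divisors are units and associates.

The product formula for `V^AB` holds because `I + A` is block diagonal along the cycles of `A`. -/

/-! ### Group rings of free abelian groups -/

section FreeAbelianGroupRing

open Module

variable {G : Type*} [AddCommGroup G]

theorem twoUniqueSums_of_free [Module.Free ℤ G] : TwoUniqueSums G :=
  (AddEquiv.twoUniqueSums_iff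
    (Module.Free.chooseBasis ℤ G).repr.toAddEquiv).2 inferInstance

theorem LaurentPolynomial.uniqueFactorizationMonoid (R : Type*) [CommRing R] [IsDomain R]
    [UniqueFactorizationMonoid R] : UniqueFactorizationMonoid (LaurentPolynomial R) :=
  UniqueFactorizationMonoid.of_isLocalization (M := Polynomial R)
    (Submonoid.powers (Polynomial.X : Polynomial R)) _

theorem AddMonoidAlgebra.isDomain_int [Module.Free ℤ G] : IsDomain (AddMonoidAlgebra ℤ G) :=
  have := twoUniqueSums_of_free (G := G)
  inferInstance

theorem AddMonoidAlgebra.uniqueFactorizationMonoid_fin (n : ℕ) :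
    UniqueFactorizationMonoid (AddMonoidAlgebra ℤ (Fin n → ℤ)) := by
  induction n with
  | zero =>
    let e : AddMonoidAlgebra ℤ (Fin 0 → ℤ) ≃+* ℤ :=
      (AddMonoidAlgebra.uniqueRingEquiv (R := ℤ) (Fin 0 → ℤ))
    exact e.toMulEquiv.symm.uniqueFactorizationMonoid inferInstance
  | succ n ih =>
    -- This makes the coefficient ring `ℤ[ℤⁿ]` a domain; `ℤ[ℤ × ℤⁿ]` is the ring of Laurent
    -- polynomials over it.
    have hU := twoUniqueSums_of_free (G := Fin n → ℤ)
    let e : (Fin (n + 1) → ℤ) ≃+ ℤ × (Fin n → ℤ) :=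
      (Fin.consLinearEquiv ℤ (fun _ : Fin (n + 1) => ℤ)).symm.toAddEquiv
    let e1 := AddMonoidAlgebra.domCongr ℤ ℤ e
    let e2 := AddMonoidAlgebra.curryAlgEquiv (M := ℤ) (N := Fin n → ℤ) (A := ℤ) ℤ
    have := LaurentPolynomial.uniqueFactorizationMonoid (AddMonoidAlgebra ℤ (Fin n → ℤ))
    exact (e1.trans e2).toMulEquiv.symm.uniqueFactorizationMonoid this

theorem AddMonoidAlgebra.uniqueFactorizationMonoid_int [Module.Free ℤ G] [Module.Finite ℤ G] :
    UniqueFactorizationMonoid (AddMonoidAlgebra ℤ G) :=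
  (AddMonoidAlgebra.domCongr ℤ ℤ
    (Module.finBasis ℤ G).equivFun.toAddEquiv).toMulEquiv.symm.uniqueFactorizationMonoid
      (AddMonoidAlgebra.uniqueFactorizationMonoid_fin _)

/-- The group ring of a free abelian group has only trivial units. -/
theorem AddMonoidAlgebra.eq_single_of_isUnit [Module.Free ℤ G] {p : AddMonoidAlgebra ℤ G}
    (hp : IsUnit p) : ∃ (ε : ℤˣ) (g : G), p = AddMonoidAlgebra.single g (ε : ℤ) := by
  classical
  have := twoUniqueSums_of_free (G := G)
  have := AddMonoidAlgebra.isDomain_int (G := G)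
  obtain ⟨q, hpq⟩ := hp.exists_right_inv
  have hp0 : p ≠ 0 := left_ne_zero_of_mul_eq_one hpq
  have hq0 : q ≠ 0 := right_ne_zero_of_mul_eq_one hpq
  have hps : 0 < p.coeff.support.card := by simpa [Finset.card_pos] using hp0
  have hqs : 0 < q.coeff.support.card := by simpa [Finset.card_pos] using hq0
  -- A sum attained only once gives a nonzero coefficient of `p * q = 1`. So two such pairs would
  -- both have sum zero, against uniqueness, and the supports are singletons.
  have hzero : ∀ a ∈ p.coeff.support, ∀ b ∈ q.coeff.support,
      UniqueAdd p.coeff.support q.coeff.support a b → a + b = 0 := by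
    intro a ha b hb hu
    have h := AddMonoidAlgebra.coeff_mul_add_of_uniqueAdd hu
    rw [hpq] at h
    by_contra hne
    rw [AddMonoidAlgebra.one_def, AddMonoidAlgebra.coeff_single,
      Finsupp.single_eq_of_ne hne] at h
    exact mul_ne_zero (Finsupp.mem_support_iff.1 ha) (Finsupp.mem_support_iff.1 hb) h.symm
  have hcard : p.coeff.support.card * q.coeff.support.card ≤ 1 := by
    by_contra hlt
    obtain ⟨x, hx, y, hy, hne, hux, huy⟩ :=
      TwoUniqueSums.uniqueAdd_of_one_lt_card (not_le.1 hlt)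
    rw [Finset.mem_product] at hx hy
    have h1 := hzero _ hx.1 _ hx.2 hux
    have h2 := hzero _ hy.1 _ hy.2 huy
    have h3 := hux hy.1 hy.2 (h2.trans h1.symm)
    exact hne (Prod.ext h3.1.symm h3.2.symm)
  have hp1 : p.coeff.support.card = 1 := by nlinarith
  have hq1 : q.coeff.support.card = 1 := by nlinarith
  obtain ⟨a, c, -, ha⟩ := Finsupp.card_support_eq_one'.1 hp1
  obtain ⟨b, d, -, hb⟩ := Finsupp.card_support_eq_one'.1 hq1
  have ha' : p = AddMonoidAlgebra.single a c := AddMonoidAlgebra.coeff_injective ha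
  have hb' : q = AddMonoidAlgebra.single b d := AddMonoidAlgebra.coeff_injective hb
  rw [ha', hb', AddMonoidAlgebra.single_mul_single, AddMonoidAlgebra.one_def] at hpq
  have hcd : c * d = 1 := by
    rcases (AddMonoidAlgebra.single_inj).1 hpq with h | h
    · exact h.2
    · exact absurd h.2 one_ne_zero
  exact ⟨Units.mkOfMulEqOne c d hcd, a, ha'⟩

/-! ### Substituting a sign for a primitive element of `G` -/

section Specialization

variable (x : G) (a : G →+ ℤ) (ε : ℤˣ)

/-- The endomorphism of `ℤ[G]` which substitutes the sign `ε` for `x`, where `a x = 1`. -/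
noncomputable def AddMonoidAlgebra.specialize :
    AddMonoidAlgebra ℤ G →ₐ[ℤ] AddMonoidAlgebra ℤ G :=
  AddMonoidAlgebra.lift ℤ _ G
    { toFun := fun g => AddMonoidAlgebra.single (g.toAdd - a g.toAdd • x)
        (((ε ^ a g.toAdd : ℤˣ)) : ℤ)
      map_one' := by simp [AddMonoidAlgebra.one_def]
      map_mul' := fun g h => by
        rw [AddMonoidAlgebra.single_mul_single, toAdd_mul, map_add, zpow_add, Units.val_mul,
          add_smul]
        congr 1
        abel }

theorem AddMonoidAlgebra.specialize_single (g : G) :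
    AddMonoidAlgebra.specialize x a ε (AddMonoidAlgebra.single g 1)
      = AddMonoidAlgebra.single (g - a g • x) ((ε ^ a g : ℤˣ) : ℤ) := by
  simp [AddMonoidAlgebra.specialize, AddMonoidAlgebra.lift_single]

theorem AddMonoidAlgebra.single_sub_dvd_zsmul (n : ℤ) :
    (AddMonoidAlgebra.single x 1 - AddMonoidAlgebra.single 0 (ε : ℤ) : AddMonoidAlgebra ℤ G) ∣
      AddMonoidAlgebra.single (n • x) 1 - AddMonoidAlgebra.single 0 ((ε ^ n : ℤˣ) : ℤ) := by
  have hnat : ∀ k : ℕ, (AddMonoidAlgebra.single x 1 - AddMonoidAlgebra.single 0 (ε : ℤ) :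
      AddMonoidAlgebra ℤ G) ∣
      AddMonoidAlgebra.single (k • x) 1 - AddMonoidAlgebra.single 0 ((ε ^ k : ℤˣ) : ℤ) := by
    intro k
    have := sub_dvd_pow_sub_pow (AddMonoidAlgebra.single x 1 : AddMonoidAlgebra ℤ G)
      (AddMonoidAlgebra.single 0 (ε : ℤ)) k
    simpa [AddMonoidAlgebra.single_pow] using this
  obtain ⟨k, rfl | rfl⟩ := n.eq_nat_or_neg
  · simpa using hnat k
  · have h : (AddMonoidAlgebra.single ((-(k : ℤ)) • x) 1
        - AddMonoidAlgebra.single 0 ((ε ^ (-(k : ℤ)) : ℤˣ) : ℤ) : AddMonoidAlgebra ℤ G)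
        = -(AddMonoidAlgebra.single ((-(k : ℤ)) • x) (((ε ^ k)⁻¹ : ℤˣ) : ℤ)) *
          (AddMonoidAlgebra.single (k • x) 1
            - AddMonoidAlgebra.single 0 ((ε ^ k : ℤˣ) : ℤ)) := by
      rw [mul_sub, neg_mul, neg_mul, AddMonoidAlgebra.single_mul_single,
        AddMonoidAlgebra.single_mul_single, ← Units.val_mul, inv_mul_cancel]
      simp only [mul_one, add_zero, Units.val_one, zpow_neg, zpow_natCast, neg_sub_neg]
      simp
    rw [h]
    exact (hnat k).mul_left _

/-- Replacing `x` by `ε` does not change the class modulo `x - ε`. Hence anything specialized to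
zero is a multiple of `x - ε`. -/
theorem AddMonoidAlgebra.single_sub_dvd_sub_specialize (p : AddMonoidAlgebra ℤ G) :
    (AddMonoidAlgebra.single x 1 - AddMonoidAlgebra.single 0 (ε : ℤ)) ∣
      p - AddMonoidAlgebra.specialize x a ε p := by
  induction p using AddMonoidAlgebra.induction_on with
  | of g =>
    change _ ∣ AddMonoidAlgebra.single g 1
      - AddMonoidAlgebra.specialize x a ε (AddMonoidAlgebra.single g 1)
    have h : AddMonoidAlgebra.single g 1
        - AddMonoidAlgebra.specialize x a ε (AddMonoidAlgebra.single g 1)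
        = AddMonoidAlgebra.single (g - a g • x) 1 * (AddMonoidAlgebra.single (a g • x) 1
          - AddMonoidAlgebra.single 0 ((ε ^ a g : ℤˣ) : ℤ)) := by
      rw [AddMonoidAlgebra.specialize_single, mul_sub, AddMonoidAlgebra.single_mul_single,
        AddMonoidAlgebra.single_mul_single]
      simp
    rw [h]
    exact (AddMonoidAlgebra.single_sub_dvd_zsmul x ε _).mul_left _
  | add p q hp hq =>
    rw [map_add, add_sub_add_comm]
    exact dvd_add hp hq
  | smul r p hp =>
    rw [map_smul, ← smul_sub]
    rw [zsmul_eq_mul]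
    exact hp.mul_left _

variable {x a} in
/-- A divisor of `x ± 1`, where `x` is primitive, is a unit or is specialized to zero. -/
theorem AddMonoidAlgebra.isUnit_or_specialize_eq_zero [Module.Free ℤ G] (hx : a x = 1)
    {d : AddMonoidAlgebra ℤ G}
    (hd : d ∣ AddMonoidAlgebra.single x 1 - AddMonoidAlgebra.single 0 (ε : ℤ)) :
    IsUnit d ∨ AddMonoidAlgebra.specialize x a ε d = 0 := by
  have := AddMonoidAlgebra.isDomain_int (G := G)
  obtain ⟨q, hq⟩ := hd
  have h0 : AddMonoidAlgebra.specialize x a ε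
      (AddMonoidAlgebra.single x 1 - AddMonoidAlgebra.single 0 (ε : ℤ)) = 0 := by
    have h1 : (AddMonoidAlgebra.single 0 (ε : ℤ) : AddMonoidAlgebra ℤ G)
        = (ε : ℤ) • AddMonoidAlgebra.single 0 1 := by simp
    rw [map_sub, h1, map_smul, AddMonoidAlgebra.specialize_single,
      AddMonoidAlgebra.specialize_single, hx]
    simp
  rw [hq, map_mul] at h0
  rcases mul_eq_zero.1 h0 with h | h
  · exact Or.inr h
  -- Here the cofactor is itself a multiple of `x - ε`, so cancelling `x - ε` exhibits an inverse of
  -- `d`.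
  · left
    have hdvd := AddMonoidAlgebra.single_sub_dvd_sub_specialize x a ε q
    rw [h, sub_zero] at hdvd
    obtain ⟨q', rfl⟩ := hdvd
    have hne : (AddMonoidAlgebra.single x 1 - AddMonoidAlgebra.single 0 (ε : ℤ) :
        AddMonoidAlgebra ℤ G) ≠ 0 := by
      rw [sub_ne_zero]
      intro h'
      rcases AddMonoidAlgebra.single_inj.1 h' with h' | h'
      · rw [h'.1, map_zero] at hx
        exact zero_ne_one hx
      · exact one_ne_zero h'.1
    refine IsUnit.of_mul_eq_one q' ?_
    apply mul_left_cancel₀ hne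
    rw [mul_one]
    conv_rhs => rw [hq]
    ring

variable {x a} in
theorem AddMonoidAlgebra.isUnit_or_associated_of_dvd [Module.Free ℤ G] (hx : a x = 1)
    {d : AddMonoidAlgebra ℤ G}
    (hd : d ∣ AddMonoidAlgebra.single x 1 - AddMonoidAlgebra.single 0 (ε : ℤ)) :
    IsUnit d ∨
      Associated d (AddMonoidAlgebra.single x 1 - AddMonoidAlgebra.single 0 (ε : ℤ)) := by
  have := AddMonoidAlgebra.isDomain_int (G := G)
  refine (AddMonoidAlgebra.isUnit_or_specialize_eq_zero ε hx hd).imp_right fun h => ?_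
  have hdvd := AddMonoidAlgebra.single_sub_dvd_sub_specialize x a ε d
  rw [h, sub_zero] at hdvd
  exact associated_of_dvd_dvd hd hdvd

end Specialization

/-- If the rank of `G` is at least two, then the elements `g ± 1` have no common divisor. -/
theorem AddMonoidAlgebra.isUnit_of_forall_dvd [Module.Free ℤ G] [Module.Finite ℤ G]
    (hG : 1 < Module.finrank ℤ G) {d : AddMonoidAlgebra ℤ G}
    (hd : ∀ g : G, ∃ ε : ℤˣ,
      d ∣ AddMonoidAlgebra.single g 1 - AddMonoidAlgebra.single 0 (ε : ℤ)) : IsUnit d := by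
  let b := Module.finBasis ℤ G
  let i : Fin (Module.finrank ℤ G) := ⟨0, by omega⟩
  let j : Fin (Module.finrank ℤ G) := ⟨1, hG⟩
  have hij : j ≠ i := by simp [i, j]
  let a : G →+ ℤ := (b.coord i).toAddMonoidHom
  have hi : a (b i) = 1 := by simp [a]
  have hj : a (b j) = 0 := by simp [a, Finsupp.single_eq_of_ne hij.symm]
  obtain ⟨ε, hε⟩ := hd (b i)
  obtain ⟨δ, hδ⟩ := hd (b j)
  refine (AddMonoidAlgebra.isUnit_or_specialize_eq_zero ε hi hε).resolve_right fun h => ?_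
  -- The substitution for `b i` kills `d` but fixes `b j - δ`, which would have to vanish.
  have h1 := map_dvd (AddMonoidAlgebra.specialize (b i) a ε) hδ
  have h2 : (AddMonoidAlgebra.single 0 (δ : ℤ) : AddMonoidAlgebra ℤ G)
      = (δ : ℤ) • AddMonoidAlgebra.single 0 1 := by simp
  rw [h, zero_dvd_iff, map_sub, h2, map_smul, AddMonoidAlgebra.specialize_single,
    AddMonoidAlgebra.specialize_single, hj, sub_eq_zero] at h1
  simp only [zero_smul, sub_zero, zpow_zero, Units.val_one, map_zero,
    AddMonoidAlgebra.smul_single, smul_eq_mul, mul_one] at h1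
  rcases AddMonoidAlgebra.single_inj.1 h1 with h' | h'
  · exact b.ne_zero j h'.1
  · exact one_ne_zero h'.1

/-- A generator of a free abelian group of positive rank is mapped to `1` by a homomorphism to `ℤ`. -/
theorem exists_addMonoidHom_eq_one {G : Type*} [AddCommGroup G] [Module.Free ℤ G]
    (hG : 0 < Module.finrank ℤ G) {t : G} (ht : AddSubgroup.zmultiples t = ⊤) :
    ∃ a : G →+ ℤ, a t = 1 := by
  have := Module.finite_of_finrank_pos hG
  let b := Module.finBasis ℤ G
  let i : Fin (Module.finrank ℤ G) := ⟨0, hG⟩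
  obtain ⟨m, hm⟩ := AddSubgroup.mem_zmultiples_iff.1 (ht ▸ AddSubgroup.mem_top (b i))
  refine ⟨m • (b.coord i).toAddMonoidHom, ?_⟩
  have h : b.coord i (m • t) = 1 := by rw [hm]; simp
  simpa using h

end FreeAbelianGroupRing

/-! ### The determinant of the sum of the identity and a weighted permutation matrix -/

section WeightedPermutation

variable {α K : Type*} [Fintype α] [CommRing K]

-- In the Leibniz formula only permutations with `ρ i = i` or `ρ i = σ i` for all `i` contribute. If
-- `ρ` moves one point, injectivity forces it to follow `σ` along the whole cycle, so only `1` and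
-- `σ` survive. The one-point case is separate because there `σ = 1`.
open Classical in
theorem Matrix.det_one_add_weighted_of_sameCycle [Nonempty α] (σ : Equiv.Perm α)
    (hσ : ∀ x y, σ.SameCycle x y) (w : α → K) :
    (1 + Matrix.of fun i j => if i = σ j then w i else 0 : Matrix α α K).det
      = 1 + (-1) ^ (Fintype.card α + 1) * ∏ i, w i := by
  rcases subsingleton_or_nontrivial α with hα | hα
  · obtain ⟨x⟩ := ‹Nonempty α›
    have := uniqueOfSubsingleton x
    have hx : ∀ y : α, y = x := fun y => Subsingleton.elim _ _
    rw [Matrix.det_unique, Fintype.card_unique, Fintype.prod_unique]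
    simp [hx (σ _), hx default]
  · have hne : ∀ x, σ x ≠ x := by
      intro x hx
      obtain ⟨y, hy⟩ := exists_ne x
      obtain ⟨n, hn⟩ := hσ x y
      rw [Equiv.Perm.zpow_apply_eq_self_of_apply_eq_self hx] at hn
      exact hy hn.symm
    have hcycle : σ.IsCycle := by
      obtain ⟨x, -⟩ := exists_pair_ne α
      exact ⟨x, hne x, fun y _ => hσ x y⟩
    have hsupp : σ.support = Finset.univ := by
      ext x
      simp [hne]
    have hσ1 : (1 : Equiv.Perm α) ≠ σ := fun h => hcycle.ne_one h.symm
    rw [Matrix.det_apply', Fintype.sum_eq_add _ _ hσ1]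
    · congr 1
      · have : ∀ i, i ≠ σ i := fun i => (hne i).symm
        simp [this]
      · rw [hcycle.sign, hsupp, Finset.card_univ, ← Equiv.prod_comp σ w]
        have : ∀ i, (1 : Matrix α α K) (σ i) i = 0 := fun i => Matrix.one_apply_ne (hne i)
        simp [this, pow_succ]
    · rintro ρ ⟨hρ1, hρσ⟩
      by_contra hnz
      have hprod := right_ne_zero_of_mul hnz
      have hentry : ∀ i, ρ i = i ∨ ρ i = σ i := by
        intro i
        by_contra! h
        refine hprod (Finset.prod_eq_zero (Finset.mem_univ i) ?_)
        simp [Matrix.one_apply_ne h.1, h.2]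
      obtain ⟨x, hx⟩ : ∃ x, ρ x ≠ x := by
        by_contra! h
        exact hρ1 (Equiv.ext h)
      have hstep : ∀ y, ρ y = σ y → ρ (σ y) = σ (σ y) := by
        intro y hy
        refine (hentry (σ y)).resolve_left fun h => ?_
        rw [← hy] at h
        exact hne y (hy ▸ ρ.injective h)
      have hpow : ∀ n : ℕ, ρ ((σ ^ n) x) = σ ((σ ^ n) x) := by
        intro n
        induction n with
        | zero => exact (hentry x).resolve_left hx
        | succ n ih =>
          rw [pow_succ', Equiv.Perm.mul_apply]
          exact hstep _ ih
      refine hρσ (Equiv.ext fun y => ?_)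
      obtain ⟨n, hn⟩ := (hσ x y).exists_nat_pow_eq
      rw [← hn]
      exact hpow n

open Classical in
theorem Matrix.det_one_add_weighted (σ : Equiv.Perm α) (w : α → K)
    [Fintype (Quotient (Equiv.Perm.SameCycle.setoid σ))] :
    (1 + Matrix.of fun i j => if i = σ j then w i else 0 : Matrix α α K).det
      = ∏ c : Quotient (Equiv.Perm.SameCycle.setoid σ),
        (1 + (-1) ^ (Finset.card {i : α | Quotient.mk _ i = c} + 1)
          * ∏ i with Quotient.mk (Equiv.Perm.SameCycle.setoid σ) i = c, w i) := by
  let b : α → Quotient (Equiv.Perm.SameCycle.setoid σ) := Quotient.mk _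
  have hb : ∀ i, b (σ i) = b i := fun i =>
    Quotient.sound (Equiv.Perm.sameCycle_apply_left.2 (Equiv.Perm.SameCycle.refl _ _))
  -- The matrix is block diagonal along the cycles; any order on them serves to view it as block
  -- triangular.
  let _ : LinearOrder (Quotient (Equiv.Perm.SameCycle.setoid σ)) := linearOrderOfSTO WellOrderingRel
  have htri : Matrix.BlockTriangular
      (1 + Matrix.of fun i j => if i = σ j then w i else 0 : Matrix α α K) b := by
    intro i j hij
    have h1 : i ≠ j := fun h => hij.ne (h ▸ rfl)
    have h2 : i ≠ σ j := fun h => hij.ne (by rw [h, hb])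
    simp [Matrix.one_apply_ne h1, h2]
  rw [htri.det_fintype]
  refine Finset.prod_congr rfl fun c _ => ?_
  have hc : ∀ i, b (σ i) = c ↔ b i = c := fun i => by rw [hb]
  have : Nonempty {i // b i = c} := by
    obtain ⟨i, hi⟩ := Quotient.exists_rep c
    exact ⟨⟨i, hi⟩⟩
  have hblock := Matrix.det_one_add_weighted_of_sameCycle (σ.subtypePerm hc)
    (fun x y => Equiv.Perm.sameCycle_subtypePerm.2 (Quotient.exact (x.2.trans y.2.symm)))
    (fun i : {i // b i = c} => w i)
  rw [Fintype.card_subtype] at hblock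
  have hprod : ∏ i : {i // b i = c}, w i = ∏ i with b i = c, w i :=
    (Finset.prod_subtype _ (by simp) w).symm
  rw [hprod] at hblock
  convert hblock using 2
  ext i j
  simp [Matrix.toSquareBlock_def, Matrix.one_apply, Subtype.ext_iff]

end WeightedPermutation

/-! ### The AB polynomial as a product over the AB-cycles -/

namespace VeeringTriangulation

variable {T : Type*} (τ : VeeringTriangulation T)

theorem mon_zero : τ.mon 0 = 1 := rfl

theorem mon_add (g h : τ.G) : τ.mon (g + h) = τ.mon g * τ.mon h := by
  simp [mon, AddMonoidAlgebra.single_mul_single]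

theorem mon_sum {ι : Type*} (S : Finset ι) (g : ι → τ.G) :
    τ.mon (∑ i ∈ S, g i) = ∏ i ∈ S, τ.mon (g i) := by
  classical
  induction S using Finset.induction_on with
  | empty => simp [mon_zero]
  | insert i S hi ih => rw [Finset.sum_insert hi, Finset.prod_insert hi, mon_add, ih]

/-- The class of an AB-cycle is the total translation along its faces. -/
theorem Lift.sum_face_abFaces {τ : VeeringTriangulation T} [Finite T] (s : τ.Lift) (c : τ.ABCycle) :
    ∑ f ∈ τ.abFaces c, s.face f = τ.abClass c := by
  rw [abClass, ← s.shift_cycle]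
  simp [abChain, Lift.face]

theorem abPolynomial_eq_prod [Finite T] (s : τ.Lift) :
    τ.abPolynomial s
      = ∏ c : τ.ABCycle, (1 + (-1) ^ (τ.abLength c + 1) * τ.mon (τ.abClass c)) := by
  classical
  have h := Matrix.det_one_add_weighted τ.abPerm fun f => τ.mon (s.face f)
  have hW : (Matrix.of fun i j => if i = τ.abPerm j then τ.mon (s.face i) else 0)
      = Matrix.of fun i j => if i = τ.abNext j then τ.mon (s.face i) else 0 := rfl
  rw [hW] at h
  rw [abPolynomial, matLAB]
  convert h using 1
  refine Finset.prod_congr rfl fun c _ => ?_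
  rw [← s.sum_face_abFaces, mon_sum, abLength, abFaces]

end VeeringTriangulation

/-! ### The combinatorics of veering triangulations -/

namespace TetEdge

theorem map_mem {σ : Equiv.Perm (Fin 4)} {c : TetEdge} {i : Fin 4} :
    σ i ∈ (c.map σ).1 ↔ i ∈ c.1 := by
  simp [map, Sym2.mem_map]

theorem map_inv_map (σ : Equiv.Perm (Fin 4)) (c : TetEdge) : (c.map σ).map σ⁻¹ = c := by
  apply Subtype.ext
  have h : (σ⁻¹ : Equiv.Perm (Fin 4)) ∘ σ = id := by
    ext i
    simp
  change (c.1.map σ).map (σ⁻¹ : Equiv.Perm (Fin 4)) = c.1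
  rw [Sym2.map_map, h, Sym2.map_id, id]

theorem map_map_inv (σ : Equiv.Perm (Fin 4)) (c : TetEdge) : (c.map σ⁻¹).map σ = c := by
  simpa using map_inv_map σ⁻¹ c

end TetEdge

namespace ModelTet

/-- A top face which contains a given edge other than the bottom edge. -/
def upFace (c : TetEdge) : Fin 4 := if 0 ∈ c.1 then 1 else 0

/-- The bottom face which contains a given side. -/
def downFace (c : TetEdge) : Fin 4 := if 2 ∈ c.1 then 3 else 2

theorem upFace_notMem : ∀ c : TetEdge, c ≠ bot → upFace c ∉ c.1 := by decide

theorem upFace_eq (c : TetEdge) : upFace c = 0 ∨ upFace c = 1 := by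
  unfold upFace
  split_ifs <;> simp

theorem downFace_eq :
    ∀ (c : TetEdge) (j : Fin 4), j = 2 ∨ j = 3 → j ∉ c.1 → c ≠ bot → downFace c = j := by decide

theorem top_mem : ∀ j : Fin 4, j = 2 ∨ j = 3 → j ∈ top.1 := by decide

theorem top_ne_bot : top ≠ bot := by decide

theorem not_isBottomFace {i : Fin 4} (h : i = 0 ∨ i = 1) : ¬ IsBottomFace i := by
  rcases h with rfl | rfl <;> simp [IsBottomFace]

/-- The veers of the edges of the model tetrahedron, `true` for right, in terms of the veers of the
top and the bottom edge. -/
def color (v w : Bool) (c : TetEdge) : Bool :=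
  if c = nw ∨ c = se then true else if c = sw ∨ c = ne then false else if c = top then v else w

/-- The side of a given veer of a face. -/
def faceSide (i : Fin 4) : Bool → TetEdge
  | true => if i = 1 ∨ i = 3 then nw else se
  | false => if i = 1 ∨ i = 2 then sw else ne

/-- If a top face `i` is glued to a bottom face of another tetrahedron, then the bottom edge of the
latter is glued to the side of the face `i` with the same veer as the top edge. -/
theorem map_faceSide_of_color : ∀ (σ : Equiv.Perm (Fin 4)) (i : Fin 4),
    i = 0 ∨ i = 1 → σ i = 2 ∨ σ i = 3 → Equiv.Perm.sign σ = -1 → ∀ v w : Bool,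
    (∀ c : TetEdge, i ∉ c.1 → color v false c = color false w (c.map σ)) →
    (faceSide i v).map σ = bot := by
  decide

/-- The bottom edge lies on no top face and the top edge on no bottom face. So at a glued face the
veers of these two edges are irrelevant, and `false` serves as a placeholder. -/
theorem color_of_ne_bot (v w : Bool) {c : TetEdge} (h : c ≠ bot) :
    color v w c = color v false c := by
  revert v w c
  decide

theorem color_of_ne_top (v w : Bool) {c : TetEdge} (h : c ≠ top) :
    color v w c = color false w c := by
  simp [color, h]

theorem ne_bot_of_notMem : ∀ {i : Fin 4} {c : TetEdge}, i = 0 ∨ i = 1 → i ∉ c.1 → c ≠ bot := by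
  decide

end ModelTet

namespace VeeringTriangulation

open ModelTet

variable {T : Type*} (τ : VeeringTriangulation T)

theorem edge_adj {t : T} {i : Fin 4} {c : TetEdge} (h : i ∉ c.1) :
    τ.edge (τ.adj t i) (c.map (τ.glue t i)) = τ.edge t c :=
  (Quot.sound ⟨i, h, rfl⟩ : τ.edge t c = τ.edge (τ.adj t i) (c.map (τ.glue t i))).symm

/-! #### The bottom edges -/

/-- Going up around an edge of the triangulation. -/
def cornerUp (x : T × TetEdge) : T × TetEdge :=
  (τ.adj x.1 (upFace x.2), x.2.map (τ.glue x.1 (upFace x.2)))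

/-- Going down around an edge of the triangulation. -/
def cornerDown (x : T × TetEdge) : T × TetEdge :=
  (τ.adj x.1 (downFace x.2), x.2.map (τ.glue x.1 (downFace x.2)))

theorem isBottomFace_cornerUp (x : T × TetEdge) :
    IsBottomFace (τ.glue x.1 (upFace x.2) (upFace x.2)) :=
  (τ.coorientation _ _).2 (not_isBottomFace (upFace_eq x.2))

theorem cornerUp_ne_top {x : T × TetEdge} (h : x.2 ≠ bot) : (τ.cornerUp x).2 ≠ top := by
  intro h'
  have h1 := top_mem _ (τ.isBottomFace_cornerUp x)
  rw [← h', cornerUp, TetEdge.map_mem] at h1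
  exact upFace_notMem _ h h1

theorem edge_cornerUp {x : T × TetEdge} (h : x.2 ≠ bot) :
    τ.edge (τ.cornerUp x).1 (τ.cornerUp x).2 = τ.edge x.1 x.2 :=
  τ.edge_adj (upFace_notMem _ h)

theorem cornerDown_cornerUp {x : T × TetEdge} (h : x.2 ≠ bot) (h' : (τ.cornerUp x).2 ≠ bot) :
    τ.cornerDown (τ.cornerUp x) = x := by
  have hd : downFace (τ.cornerUp x).2 = τ.glue x.1 (upFace x.2) (upFace x.2) := by
    refine downFace_eq _ _ (τ.isBottomFace_cornerUp x) ?_ h'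
    rw [cornerUp, TetEdge.map_mem]
    exact upFace_notMem _ h
  rw [cornerDown, hd]
  simp only [cornerUp]
  rw [τ.adj_adj, τ.glue_glue, TetEdge.map_inv_map]

/-- Each top edge is the bottom edge of some tetrahedron. -/
theorem exists_edge_bot_eq_edge_top [Finite T] (t : T) : ∃ t', τ.edge t' bot = τ.edge t top := by
  by_contra! hcon
  -- Walk up around the top edge of `t`. If no bottom edge is ever met, the walk can be reversed by
  -- `cornerDown`, so by finiteness it returns to its start. But the start is a top edge, and a step
  -- up never ends at one.
  let x : ℕ → T × TetEdge := fun n => τ.cornerUp^[n] (t, top)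
  have hsucc : ∀ n, x (n + 1) = τ.cornerUp (x n) := fun n => Function.iterate_succ_apply' _ _ _
  have hx : ∀ n, τ.edge (x n).1 (x n).2 = τ.edge t top ∧ (x n).2 ≠ bot := by
    intro n
    induction n with
    | zero => exact ⟨rfl, top_ne_bot⟩
    | succ n ih =>
      have he : τ.edge (x (n + 1)).1 (x (n + 1)).2 = τ.edge t top := by
        rw [hsucc, τ.edge_cornerUp ih.2, ih.1]
      refine ⟨he, fun h => hcon (x (n + 1)).1 ?_⟩
      rw [← he, h]
  have hdown : ∀ n, τ.cornerDown (x (n + 1)) = x n := by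
    intro n
    rw [hsucc]
    exact τ.cornerDown_cornerUp (hx n).2 (hsucc n ▸ (hx (n + 1)).2)
  have hback : ∀ m n, x m = x (m + n) → x 0 = x n := by
    intro m
    induction m with
    | zero => intro n h; simpa using h
    | succ m ih =>
      intro n h
      refine ih n ?_
      rw [← hdown m, h, Nat.add_right_comm, hdown]
  obtain ⟨m, n, hmn, hxmn⟩ := Finite.exists_ne_map_eq_of_infinite x
  wlog hlt : m < n generalizing m n
  · exact this n m hmn.symm hxmn.symm (lt_of_le_of_ne (not_lt.1 hlt) hmn.symm)
  obtain ⟨k, rfl⟩ := Nat.exists_eq_add_of_lt hlt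
  have h0 := hback m (k + 1) hxmn
  have h1 := τ.cornerUp_ne_top (hx k).2
  rw [← hsucc, ← h0] at h1
  exact h1 rfl

theorem edge_bot_surjective [Finite T] : Function.Surjective fun t => τ.edge t bot := by
  intro e
  have hne : Nonempty {x : T × TetEdge // τ.edge x.1 x.2 = e ∧ (x.2 = bot ∨ x.2 = top)} := by
    by_contra h
    have := τ.angle_sum e
    rw [not_nonempty_iff] at h
    rw [Nat.card_of_isEmpty] at this
    exact two_ne_zero this.symm
  obtain ⟨⟨⟨t, c⟩, he, rfl | rfl⟩⟩ := hne
  · exact ⟨t, he⟩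
  · obtain ⟨t', ht'⟩ := τ.exists_edge_bot_eq_edge_top t
    exact ⟨t', ht'.trans he⟩

/-- Double counting of the angles `π`: each tetrahedron has two, and each edge receives two. -/
theorem card_edge [Fintype T] : Fintype.card τ.Edge = Fintype.card T := by
  classical
  let S : Finset (T × TetEdge) := Finset.univ ×ˢ {bot, top}
  have h1 : S.card = Fintype.card T * 2 := by
    rw [Finset.card_product, Finset.card_univ, Finset.card_pair top_ne_bot.symm]
  have h2 : S.card = Fintype.card τ.Edge * 2 := by
    rw [Finset.card_eq_sum_card_fiberwise (f := fun x => τ.edge x.1 x.2) (t := Finset.univ)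
      (fun _ _ => Finset.mem_coe.2 (Finset.mem_univ _))]
    rw [Finset.sum_const_nat (m := 2), Finset.card_univ]
    intro e _
    rw [← τ.angle_sum e, Nat.card_eq_fintype_card, Fintype.card_subtype]
    congr 1
    ext x
    simp [S, and_comm]
  omega

/-- The bijection which sends a tetrahedron to its bottom edge. -/
noncomputable def botEquiv [Fintype T] : T ≃ τ.Edge :=
  Equiv.ofBijective (fun t => τ.edge t bot)
    ((Fintype.bijective_iff_surjective_and_card _).2 ⟨τ.edge_bot_surjective, τ.card_edge.symm⟩)

/-! #### The veers of the edges of a face -/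

/-- The veer of an edge, as a Boolean. -/
def veerBool (e : τ.Edge) : Bool :=
  match τ.veer e with
  | Veer.right => true
  | Veer.left => false

theorem veerBool_edge (t : T) (c : TetEdge) :
    τ.veerBool (τ.edge t c)
      = color (τ.veerBool (τ.edge t top)) (τ.veerBool (τ.edge t bot)) c := by
  have key : ∀ c : TetEdge, c = nw ∨ c = se ∨ c = sw ∨ c = ne ∨ c = top ∨ c = bot := by decide
  rcases key c with rfl | rfl | rfl | rfl | rfl | rfl
  · simp [veerBool, τ.veer_nw, color]
  · simp [veerBool, τ.veer_se, color]
  · rw [veerBool, τ.veer_sw]; rfl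
  · rw [veerBool, τ.veer_ne]; rfl
  · rfl
  · rfl

/-- A top face is glued to the tetrahedron above it in such a way that the bottom edge of the latter
is the side of the face with the same veer as the top edge of the tetrahedron below. -/
theorem map_faceSide {t : T} {i : Fin 4} (hi : i = 0 ∨ i = 1) :
    (faceSide i (τ.veerBool (τ.edge t top))).map (τ.glue t i) = bot := by
  have hb := (τ.coorientation t i).2 (not_isBottomFace hi)
  refine map_faceSide_of_color _ i hi hb (τ.orientation t i) _
    (τ.veerBool (τ.edge (τ.adj t i) bot)) fun c hc => ?_
  have htop : c.map (τ.glue t i) ≠ top := fun h => by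
    have := top_mem _ hb
    rw [← h, TetEdge.map_mem] at this
    exact hc this
  rw [← color_of_ne_bot _ (τ.veerBool (τ.edge t bot)) (ne_bot_of_notMem hi hc),
    ← color_of_ne_top (τ.veerBool (τ.edge (τ.adj t i) top)) _ htop, ← veerBool_edge,
    ← veerBool_edge, τ.edge_adj hc]

end VeeringTriangulation

/-! ### The face relations and the tetrahedron relations -/

namespace VeeringTriangulation

open ModelTet

variable {T : Type*} {τ : VeeringTriangulation T}

namespace Lift

variable (s : τ.Lift)

/-- The relation between the translations along the edges of a triangle of the 2-complex. -/
theorem face_add_corner (f : τ.Face) {c : TetEdge} (h : f.idx ∉ c.1) :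
    s.face f + s.corner f.above c = s.corner f.below (c.map (τ.glue f.above f.idx)) := by
  let z : τ.Cell1 →₀ ℤ := τ.boundary2 (Finsupp.single ⟨(f, c), h⟩ 1)
  have hz : z = Finsupp.single (Sum.inl f) 1 + Finsupp.single (Sum.inr (f.above, c)) 1
      - Finsupp.single (Sum.inr (f.below, c.map (τ.glue f.above f.idx))) 1 := by
    simp [z, boundary2]
  have he : τ.edge f.below (c.map (τ.glue f.above f.idx)) = τ.edge f.above c := τ.edge_adj h
  have hz1 : z ∈ τ.Z1 := by
    rw [LinearMap.mem_ker, hz]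
    simp [boundary1, he]
  have hcls : τ.cls ⟨z, hz1⟩ = 0 := by
    have h0 : ((LinearMap.range τ.boundary2).comap τ.Z1.subtype).mkQ ⟨z, hz1⟩ = 0 := by
      rw [Submodule.mkQ_apply, Submodule.Quotient.mk_eq_zero]
      exact LinearMap.mem_range_self _ _
    rw [cls, LinearMap.comp_apply, h0, map_zero]
  rw [← s.shift_cycle ⟨z, hz1⟩] at hcls
  change s.shift z = 0 at hcls
  rw [hz, map_sub, map_add] at hcls
  exact sub_eq_zero.1 hcls

open Classical in
/-- The edge `c` of the chosen lift of `t`, as an element of `ℤ[G]^E`. -/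
noncomputable def cornerVec (t : T) (c : TetEdge) : τ.Edge → τ.GroupRing :=
  Pi.single (τ.edge t c) (τ.mon (s.corner t c))

theorem cornerVec_below (f : τ.Face) {c : TetEdge} (h : f.idx ∉ c.1) :
    s.cornerVec f.below (c.map (τ.glue f.above f.idx))
      = τ.mon (s.face f) • s.cornerVec f.above c := by
  classical
  have he : τ.edge f.below (c.map (τ.glue f.above f.idx)) = τ.edge f.above c := τ.edge_adj h
  rw [cornerVec, cornerVec, he, ← s.face_add_corner f h, mon_add, ← smul_eq_mul, Pi.single_smul]

open Classical in
theorem faceRel_eq (f : τ.Face) :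
    τ.faceRel s f = s.cornerVec f.above bot
      - ∑ c : TetEdge with f.idx ∉ c.1 ∧ c ≠ bot, s.cornerVec f.above c := rfl

open Classical in
theorem mon_smul_tetRel (t : T) :
    τ.mon (s.corner t bot) • τ.tetRel s t = s.cornerVec t bot
      - ∑ c ∈ insert top (sides (τ.veer (τ.edge t top)).opp), s.cornerVec t c := by
  rw [tetRel, smul_sub, Finset.smul_sum, cornerVec]
  congr 1
  · rw [← Pi.single_smul, smul_eq_mul, mul_one]
  · refine Finset.sum_congr rfl fun c _ => ?_
    rw [cornerVec, ← Pi.single_smul, smul_eq_mul, ← mon_add, add_sub_cancel]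

theorem exitFace_eq (f : τ.Face) : τ.exitFace f = 0 ∨ τ.exitFace f = 1 := by
  unfold exitFace
  split_ifs <;> simp

-- The relation of `A f` is read inside `f.above`, the tetrahedron below `A f`. By `map_faceSide`,
-- the bottom edge of the tetrahedron above `A f` appears there as the side of the exit face with
-- the veer of the top edge.
open Classical in
theorem mon_smul_faceRel_abNext (f : τ.Face) :
    τ.mon (s.face (τ.abNext f)) • τ.faceRel s (τ.abNext f)
      = s.cornerVec f.above (faceSide (τ.exitFace f) (τ.veerBool (τ.edge f.above top)))
        - ∑ c : TetEdge with τ.exitFace f ∉ c.1 ∧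
            c ≠ faceSide (τ.exitFace f) (τ.veerBool (τ.edge f.above top)),
          s.cornerVec f.above c := by
  set t := f.above with ht
  set i := τ.exitFace f with hi
  set r := faceSide i (τ.veerBool (τ.edge t top)) with hr
  have hmap : r.map (τ.glue t i) = bot := τ.map_faceSide (exitFace_eq f)
  have hr' : bot.map (τ.glue t i)⁻¹ = r := by rw [← hmap, TetEdge.map_inv_map]
  have hidx : (τ.abNext f).idx = τ.glue t i i := rfl
  have hvec : ∀ c : TetEdge, (τ.abNext f).idx ∉ c.1 →
      τ.mon (s.face (τ.abNext f)) • s.cornerVec (τ.abNext f).above c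
        = s.cornerVec t (c.map (τ.glue t i)⁻¹) := by
    intro c hc
    rw [← s.cornerVec_below _ hc, τ.below_abNext]
    congr 2
    exact τ.glue_glue t i
  have hbot : ∀ j : Fin 4, IsBottomFace j → j ∉ bot.1 := by
    rintro j (rfl | rfl) <;> decide
  rw [faceRel_eq, smul_sub, Finset.smul_sum, hvec bot (hbot _ (τ.abNext f).isBottom), hr']
  congr 1
  refine Finset.sum_bij' (fun c _ => c.map (τ.glue t i)⁻¹) (fun c _ => c.map (τ.glue t i))
    ?_ ?_ ?_ ?_ ?_
  · intro c hc
    simp only [Finset.mem_filter, Finset.mem_univ, true_and, hidx] at hc ⊢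
    refine ⟨fun h => hc.1 ?_, fun h => hc.2 ?_⟩
    · rw [← TetEdge.map_map_inv (τ.glue t i) c, TetEdge.map_mem]
      exact h
    · rw [← TetEdge.map_map_inv (τ.glue t i) c, h, hmap]
  · intro c hc
    simp only [Finset.mem_filter, Finset.mem_univ, true_and, hidx] at hc ⊢
    refine ⟨fun h => hc.1 (TetEdge.map_mem.1 h), fun h => hc.2 ?_⟩
    rw [← TetEdge.map_inv_map (τ.glue t i) c, h, hr']
  · exact fun c _ => TetEdge.map_map_inv _ _
  · exact fun c _ => TetEdge.map_inv_map _ _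
  · intro c hc
    simp only [Finset.mem_filter, Finset.mem_univ, true_and] at hc
    exact hvec c hc.1

open Classical in
/-- The sum of the relations of a bottom face and of the next face in its AB-cycle is the relation of
the tetrahedron between them. -/
theorem faceRel_add_faceRel_abNext (f : τ.Face) :
    τ.faceRel s f + τ.mon (s.face (τ.abNext f)) • τ.faceRel s (τ.abNext f)
      = τ.mon (s.corner f.above bot) • τ.tetRel s f.above := by
  have sum_pair : ∀ (p : TetEdge → Prop) [DecidablePred p] (a b : TetEdge), a ≠ b → (∀ c, p c ↔ c = a ∨ c = b) →
      ∑ c with p c, s.cornerVec f.above c = s.cornerVec f.above a + s.cornerVec f.above b := by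
    intro p _ a b hab h
    rw [← Finset.sum_pair hab]
    refine Finset.sum_congr ?_ fun _ _ => rfl
    ext c
    simp [h]
  rw [s.mon_smul_faceRel_abNext, s.mon_smul_tetRel, s.faceRel_eq]
  -- In each of the four cases the edge common to `f` and `A f` cancels. What is subtracted from the
  -- bottom edge is the top edge and one side of opposite veer from each of the two faces.
  obtain hi | hi : f.idx = 2 ∨ f.idx = 3 := f.isBottom
  · rw [hi, sum_pair (fun c => 2 ∉ c.1 ∧ c ≠ bot) sw se (by decide) (by decide)]
    cases hv : τ.veer (τ.edge f.above top)
    · have he : τ.exitFace f = 1 := by simp [exitFace, commonEdge, hi, hv, τ.veer_sw]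
      have hr : faceSide 1 (τ.veerBool (τ.edge f.above top)) = sw := by
        simp [veerBool, hv, faceSide]
      rw [he, hr, sum_pair (fun c => 1 ∉ c.1 ∧ c ≠ sw) top nw (by decide) (by decide)]
      simp only [Veer.opp, sides]
      rw [Finset.sum_insert (by decide), Finset.sum_pair (by decide)]
      abel
    · have he : τ.exitFace f = 0 := by simp [exitFace, commonEdge, hi, hv, τ.veer_sw]
      have hr : faceSide 0 (τ.veerBool (τ.edge f.above top)) = se := by
        simp [veerBool, hv, faceSide]
      rw [he, hr, sum_pair (fun c => 0 ∉ c.1 ∧ c ≠ se) top ne (by decide) (by decide)]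
      simp only [Veer.opp, sides]
      rw [Finset.sum_insert (by decide), Finset.sum_pair (by decide)]
      abel
  · rw [hi, sum_pair (fun c => 3 ∉ c.1 ∧ c ≠ bot) nw ne (by decide) (by decide)]
    cases hv : τ.veer (τ.edge f.above top)
    · have he : τ.exitFace f = 0 := by simp [exitFace, commonEdge, hi, hv, τ.veer_nw]
      have hr : faceSide 0 (τ.veerBool (τ.edge f.above top)) = ne := by
        simp [veerBool, hv, faceSide]
      rw [he, hr, sum_pair (fun c => 0 ∉ c.1 ∧ c ≠ ne) top se (by decide) (by decide)]
      simp only [Veer.opp, sides]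
      rw [Finset.sum_insert (by decide), Finset.sum_pair (by decide)]
      abel
    · have he : τ.exitFace f = 1 := by simp [exitFace, commonEdge, hi, hv, τ.veer_nw]
      have hr : faceSide 1 (τ.veerBool (τ.edge f.above top)) = nw := by
        simp [veerBool, hv, faceSide]
      rw [he, hr, sum_pair (fun c => 1 ∉ c.1 ∧ c ≠ nw) top sw (by decide) (by decide)]
      simp only [Veer.opp, sides]
      rw [Finset.sum_insert (by decide), Finset.sum_pair (by decide)]
      abel

end Lift

end VeeringTriangulation

/-! ### Complementary minors -/

section ComplementaryMinors

variable {ι κ K : Type*} [Fintype ι] [Fintype κ] [CommRing K]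

open Classical in
/-- If `P * B = [L | 0]`, then the maximal minors of `P` are proportional to the complementary minors
of the right half of `B`. -/
theorem Matrix.det_submatrix_inl_mul_det (P : Matrix ι κ K) (B : Matrix κ (ι ⊕ ι) K)
    (L : Matrix ι ι K) (hinl : ∀ i j, (P * B) i (Sum.inl j) = L i j)
    (hinr : ∀ i j, (P * B) i (Sum.inr j) = 0) (σ : ι ⊕ ι ≃ κ) :
    (P.submatrix id (σ ∘ Sum.inl)).det * (B.submatrix σ id).det
      = L.det * (B.submatrix (σ ∘ Sum.inr) Sum.inr).det := by
  -- Completing `P` by an identity block on the complementary columns makes both the factor and the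
  -- product block triangular.
  have hmul : Matrix.fromBlocks (P.submatrix id (σ ∘ Sum.inl)) (P.submatrix id (σ ∘ Sum.inr)) 0 1
        * B.submatrix σ id
      = Matrix.fromBlocks L 0 (B.submatrix (σ ∘ Sum.inr) Sum.inl)
        (B.submatrix (σ ∘ Sum.inr) Sum.inr) := by
    have hrow : ∀ i j, ∑ x : ι ⊕ ι, P i (σ x) * B (σ x) j = (P * B) i j := fun i j =>
      Equiv.sum_comp σ fun x => P i x * B x j
    ext (i | i) (j | j)
    · rw [Matrix.fromBlocks_apply₁₁, ← hinl, ← hrow, Matrix.mul_apply, Fintype.sum_sum_type,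
        Fintype.sum_sum_type]
      rfl
    · rw [Matrix.fromBlocks_apply₁₂, Matrix.zero_apply, ← hinr i j, ← hrow, Matrix.mul_apply,
        Fintype.sum_sum_type, Fintype.sum_sum_type]
      rfl
    · simp [Matrix.mul_apply, Fintype.sum_sum_type, Matrix.one_apply]
    · simp [Matrix.mul_apply, Fintype.sum_sum_type, Matrix.one_apply]
  have hdet := congrArg Matrix.det hmul
  rw [Matrix.det_mul, Matrix.det_fromBlocks_zero₂₁, Matrix.det_fromBlocks_zero₁₂, Matrix.det_one,
    mul_one] at hdet
  exact hdet

theorem exists_equiv_comp_inl_eq (φ : ι ⊕ ι ≃ κ) {k : ι → κ} (hk : Function.Injective k) :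
    ∃ σ : ι ⊕ ι ≃ κ, σ ∘ Sum.inl = k := by
  classical
  have hφ : Function.Injective (φ ∘ Sum.inl) := φ.injective.comp Sum.inl_injective
  let e : Set.range (φ ∘ Sum.inl) ≃ Set.range k :=
    (Equiv.ofInjective _ hφ).symm.trans (Equiv.ofInjective k hk)
  refine ⟨φ.trans (Equiv.extendSubtype e), funext fun i => ?_⟩
  have hi : φ (Sum.inl i) ∈ Set.range (φ ∘ Sum.inl) := ⟨i, rfl⟩
  change Equiv.extendSubtype e (φ (Sum.inl i)) = k i
  rw [Equiv.extendSubtype_apply_of_mem e _ hi]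
  have hsymm : (Equiv.ofInjective _ hφ).symm ⟨φ (Sum.inl i), hi⟩ = i := by
    rw [Equiv.symm_apply_eq]
    rfl
  change ((Equiv.ofInjective k hk) ((Equiv.ofInjective _ hφ).symm ⟨φ (Sum.inl i), hi⟩) : κ) = k i
  rw [hsymm]
  rfl

theorem exists_equiv_comp_inr_eq (φ : ι ⊕ ι ≃ κ) {k : ι → κ} (hk : Function.Injective k) :
    ∃ σ : ι ⊕ ι ≃ κ, σ ∘ Sum.inr = k := by
  obtain ⟨σ, hσ⟩ := exists_equiv_comp_inl_eq φ hk
  exact ⟨(Equiv.sumComm ι ι).trans σ, hσ⟩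

end ComplementaryMinors

/-! ### Complementary minors of `L^△` and of the difference matrix -/

namespace VeeringTriangulation

open ModelTet

variable {T : Type*} (τ : VeeringTriangulation T)

/-- The bottom faces of the tetrahedra. -/
def faceEquiv : T ⊕ T ≃ τ.Face where
  toFun := Sum.elim (fun t => ⟨t, 3, Or.inr rfl⟩) (fun t => ⟨t, 2, Or.inl rfl⟩)
  invFun f := if f.idx = 3 then Sum.inl f.above else Sum.inr f.above
  left_inv := by rintro (t | t) <;> simp
  right_inv := by
    rintro ⟨t, i, rfl | rfl⟩ <;> simp

/-- The matrix whose columns are the differences of the columns of `I + A` at the two bottom faces of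
a tetrahedron. -/
noncomputable def diffMat (s : τ.Lift) : Matrix τ.Face T τ.GroupRing :=
  Matrix.of fun f t =>
    τ.matLAB s f (τ.faceEquiv (Sum.inl t)) - τ.matLAB s f (τ.faceEquiv (Sum.inr t))

theorem isUnit_mon (g : τ.G) : IsUnit (τ.mon g) :=
  IsUnit.of_mul_eq_one (τ.mon (-g)) (by rw [← mon_add, add_neg_cancel, mon_zero])

/-- The right-hand side depends on `f` only through the tetrahedron above it, so both bottom faces
of a tetrahedron give the same column. -/
theorem matLTriangle_mul_matLAB [Finite T] (s : τ.Lift) (e : τ.Edge) (f : τ.Face) :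
    (τ.matLTriangle s * τ.matLAB s) e f
      = τ.mon (s.corner f.above bot) * τ.tetRel s f.above e := by
  classical
  have h := congrFun (s.faceRel_add_faceRel_abNext f) e
  rw [Pi.add_apply, Pi.smul_apply, Pi.smul_apply, smul_eq_mul, smul_eq_mul] at h
  rw [← h, matLAB, Matrix.mul_add, Matrix.mul_one, Matrix.add_apply]
  congr 1
  rw [Matrix.mul_apply, Finset.sum_eq_single (τ.abNext f), mul_comm, Matrix.of_apply, if_pos rfl]
  · rfl
  · intro f' _ hf'
    rw [Matrix.of_apply, if_neg hf', mul_zero]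
  · exact fun h => absurd (Finset.mem_univ _) h

open Classical in
theorem associated_minor_mul_abPolynomial [Fintype T] (s : τ.Lift) (σ : T ⊕ T ≃ τ.Face) :
    Associated
      (((τ.matLTriangle s).submatrix id (σ ∘ Sum.inl ∘ τ.botEquiv.symm)).det * τ.abPolynomial s)
      (τ.veeringPolynomial s * ((τ.diffMat s).submatrix (σ ∘ Sum.inr) id).det) := by
  let P : Matrix T τ.Face τ.GroupRing := (τ.matLTriangle s).submatrix τ.botEquiv id
  -- This column operation replaces the second of the two equal columns of each tetrahedron by their
  -- difference.
  let C : Matrix (T ⊕ T) (T ⊕ T) τ.GroupRing := Matrix.fromBlocks 1 1 0 (-1)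
  let B : Matrix τ.Face (T ⊕ T) τ.GroupRing := (τ.matLAB s).submatrix id τ.faceEquiv * C
  -- These units compare two normalizations: `tetRel` is based at the chosen lift of the bottom
  -- edge, `faceRel` at that of the tetrahedron.
  let D : T → τ.GroupRing := fun t => τ.mon (s.corner t bot)
  have hBinl : ∀ f t, B f (Sum.inl t) = τ.matLAB s f (τ.faceEquiv (Sum.inl t)) := by
    intro f t
    simp [B, C, Matrix.mul_apply, Fintype.sum_sum_type, Matrix.one_apply]
  have hBinr : ∀ f t, B f (Sum.inr t) = τ.diffMat s f t := by
    intro f t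
    simp [B, C, Matrix.mul_apply, Fintype.sum_sum_type, Matrix.one_apply, diffMat, sub_eq_add_neg]
  have hPL : ∀ i f, ∑ f', P i f' * τ.matLAB s f' f
      = τ.mon (s.corner f.above bot) * τ.tetRel s f.above (τ.edge i bot) := fun i f =>
    τ.matLTriangle_mul_matLAB s (τ.edge i bot) f
  have hinl : ∀ i j, (P * B) i (Sum.inl j) = (τ.matL s * Matrix.diagonal D) i j := by
    intro i j
    rw [Matrix.mul_apply, Matrix.mul_diagonal]
    simp only [hBinl]
    rw [hPL, mul_comm]
    rfl
  have hinr : ∀ i j, (P * B) i (Sum.inr j) = 0 := by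
    intro i j
    rw [Matrix.mul_apply]
    simp only [hBinr, diffMat, Matrix.of_apply, mul_sub, Finset.sum_sub_distrib]
    rw [hPL, hPL]
    exact sub_self _
  have key := Matrix.det_submatrix_inl_mul_det P B _ hinl hinr σ
  have hminor : (P.submatrix id (σ ∘ Sum.inl)).det
      = ((τ.matLTriangle s).submatrix id (σ ∘ Sum.inl ∘ τ.botEquiv.symm)).det := by
    rw [← Matrix.det_submatrix_equiv_self τ.botEquiv]
    congr 1
    ext i j
    simp [P]
  have hdiff : (B.submatrix (σ ∘ Sum.inr) Sum.inr) = (τ.diffMat s).submatrix (σ ∘ Sum.inr) id := by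
    ext i j
    simp [hBinr]
  have hC : C.det = (-1) ^ Fintype.card T := by
    simp [C, Matrix.det_fromBlocks_zero₂₁, Matrix.det_neg]
  have hB : (B.submatrix σ id).det
      = τ.abPolynomial s * ((Equiv.Perm.sign (σ.trans τ.faceEquiv.symm) : ℤ) *
        (-1) ^ Fintype.card T) := by
    have h1 : B.submatrix σ id
        = (((τ.matLAB s).submatrix τ.faceEquiv τ.faceEquiv).submatrix
            (σ.trans τ.faceEquiv.symm) id) * C := by
      ext i j
      simp [B, Matrix.mul_apply]
    rw [h1, Matrix.det_mul, Matrix.det_permute, Matrix.det_submatrix_equiv_self, hC, abPolynomial]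
    ring
  rw [hminor, hdiff, hB, Matrix.det_mul, Matrix.det_diagonal, ← mul_assoc] at key
  have hu1 : IsUnit (((Equiv.Perm.sign (σ.trans τ.faceEquiv.symm) : ℤ) : τ.GroupRing) *
      (-1) ^ Fintype.card T) :=
    ((Equiv.Perm.sign (σ.trans τ.faceEquiv.symm)).isUnit.map
      (Int.castRingHom τ.GroupRing)).mul (isUnit_one.neg.pow _)
  have hu2 : IsUnit (∏ t, D t) := by
    rw [← mon_sum]
    exact τ.isUnit_mon _
  refine (associated_mul_unit_right _ _ hu1).trans ?_
  rw [key, mul_right_comm]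
  exact associated_mul_unit_left _ _ hu2

end VeeringTriangulation

/-! ### Common divisors of the minors of the difference matrix -/

section RowSpan

variable {ι κ S : Type*} [Fintype ι] [CommRing S]

open Classical in
/-- If all maximal minors of a matrix vanish, then so does the determinant of every square matrix
whose rows belong to its row span. -/
theorem Matrix.det_eq_zero_of_forall_mem_span [Fintype κ] (B : Matrix κ ι S)
    (hB : ∀ l : ι → κ, (B.submatrix l id).det = 0) (M : Matrix ι ι S)
    (hM : ∀ i, M i ∈ Submodule.span S (Set.range fun k => B k)) : M.det = 0 := by
  choose c hc using fun i => (Submodule.mem_span_range_iff_exists_fun S).1 (hM i)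
  -- Multilinear expansion writes the determinant as a combination of minors of `B`, possibly with
  -- repeated rows.
  have h : M = fun i => ∑ k, c i k • B k := funext fun i => (hc i).symm
  change Matrix.detRowAlternating.toMultilinearMap M = 0
  rw [h, MultilinearMap.map_sum]
  refine Finset.sum_eq_zero fun l _ => ?_
  rw [MultilinearMap.map_smul_univ]
  exact (congrArg _ (hB l)).trans (smul_zero _)

open Classical in
/-- If all determinants with rows in `N` vanish and all basis vectors are congruent modulo `N` to
multiples of a single one, then the latter has no annihilator modulo `N`. -/
theorem eq_zero_of_smul_single_mem (N : Submodule S (ι → S))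
    (hN : ∀ M : Matrix ι ι S, (∀ i, M i ∈ N) → M.det = 0) (i₀ : ι) (u : ι → S)
    (hu : ∀ i, (Pi.single i 1 - u i • Pi.single i₀ 1 : ι → S) ∈ N) {a : S}
    (ha : (a • Pi.single i₀ 1 : ι → S) ∈ N) : a = 0 := by
  let d : ι → S := fun i => if i = i₀ then a else 1
  let w : ι → S := fun i => if i = i₀ then 0 else -u i
  -- The rows are `a e_{i₀}` and, for the other `i`, `e_i - u_i e_{i₀}`. Writing them as a diagonal
  -- matrix times a rank-one perturbation of `1` gives determinant `a`.
  let M : Matrix ι ι S := Matrix.diagonal d *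
    (1 + Matrix.replicateCol Unit w * Matrix.replicateRow Unit (Pi.single i₀ 1 : ι → S))
  have hM : M.det = a := by
    rw [Matrix.det_mul, Matrix.det_one_add_replicateCol_mul_replicateRow, Matrix.det_diagonal]
    simp [d, w]
  rw [← hM]
  refine hN M fun i => ?_
  have hrow : M i = if i = i₀ then a • Pi.single i₀ 1 else Pi.single i 1 - u i • Pi.single i₀ 1 := by
    ext j
    change (Matrix.diagonal d * _ : Matrix ι ι S) i j = _
    rw [Matrix.diagonal_mul]
    split_ifs with h
    · subst h
      simp [d, w, Matrix.mul_apply, Matrix.one_apply, Pi.single_apply, eq_comm]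
    · simp [d, w, h, Matrix.mul_apply, Matrix.one_eq_pi_single, sub_eq_add_neg]
  rw [hrow]
  split_ifs
  · exact ha
  · exact hu i

end RowSpan

/-! ### The difference matrix as a twisted incidence matrix -/

namespace VeeringTriangulation

open ModelTet

variable {T : Type*} {τ : VeeringTriangulation T}

theorem cls_surjective : Function.Surjective τ.cls :=
  (Submodule.mkQ_surjective _).comp (Submodule.mkQ_surjective _)

/-- The face through which one passes from `t` to `adj t i`, up or down. -/
theorem exists_face_of_adj (t : T) (i : Fin 4) :
    ∃ f : τ.Face, (f.above = t ∧ f.below = τ.adj t i ∧ f.idx = i) ∨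
      (f.above = τ.adj t i ∧ f.below = t ∧ f.idx = τ.glue t i i ∧
        τ.glue f.above f.idx = (τ.glue t i)⁻¹) := by
  by_cases hi : IsBottomFace i
  · exact ⟨⟨t, i, hi⟩, Or.inl ⟨rfl, rfl, rfl⟩⟩
  · exact ⟨⟨τ.adj t i, τ.glue t i i, (τ.coorientation t i).2 hi⟩,
      Or.inr ⟨rfl, τ.adj_adj t i, rfl, τ.glue_glue t i⟩⟩

/-- A homomorphism from `G` which is the coboundary of a function on the tetrahedra along all faces
is trivial. -/
theorem Lift.eq_zero_of_potential (s : τ.Lift) {A : Type*} [AddCommGroup A] (Φ : τ.G →+ A)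
    (h : T → A) (hf : ∀ f : τ.Face, h f.above = Φ (s.face f) + h f.below) : Φ = 0 := by
  have hglue : ∀ x y : T × TetEdge, τ.EdgeGlued x y →
      Φ (s.corner x.1 x.2) + h x.1 = Φ (s.corner y.1 y.2) + h y.1 := by
    rintro ⟨t, c⟩ _ ⟨i, hi, rfl⟩
    dsimp only at hi ⊢
    obtain ⟨f, ⟨rfl, h2, rfl⟩ | ⟨h1, rfl, h3, h4⟩⟩ := τ.exists_face_of_adj t i
    · rw [← h2, ← s.face_add_corner f hi, map_add, hf f]
      abel
    · have hi' : f.idx ∉ (c.map (τ.glue f.below i)).1 := by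
        rw [h3, TetEdge.map_mem]
        exact hi
      have h5 := s.face_add_corner f hi'
      rw [h4, TetEdge.map_inv_map] at h5
      rw [← h1, ← h5, map_add, hf f]
      abel
  -- The triangle relations extend the potential to the remaining vertices of the 2-complex. Thus `Φ
  -- ∘ shift` is a coboundary and vanishes on cycles, whose classes exhaust `G`.
  let hE : τ.Edge → A := Quot.lift (fun x => Φ (s.corner x.1 x.2) + h x.1) hglue
  let Ψ : ((T ⊕ τ.Edge) →₀ ℤ) →ₗ[ℤ] A := Finsupp.linearCombination ℤ (Sum.elim h hE)
  have hΨ : Φ.toIntLinearMap ∘ₗ s.shift = Ψ ∘ₗ τ.boundary1 := by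
    refine Finsupp.lhom_ext' fun x => LinearMap.ext_ring ?_
    rcases x with f | ⟨t, c⟩
    · have : Φ (s.face f) = h f.above - h f.below := by rw [hf f, add_sub_cancel_right]
      simpa [Ψ, boundary1, Lift.face] using this
    · have : Φ (s.corner t c) = hE (τ.edge t c) - h t := (add_sub_cancel_right _ _).symm
      simpa [Ψ, boundary1, Lift.corner] using this
  ext g
  obtain ⟨z, rfl⟩ := cls_surjective g
  rw [← s.shift_cycle]
  have := LinearMap.congr_fun hΨ z
  rw [LinearMap.comp_apply, LinearMap.comp_apply, LinearMap.mem_ker.1 z.2, map_zero] at this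
  exact this

/-- The sign of a bottom face of a tetrahedron in the difference matrix. -/
def Face.sgn (f : τ.Face) : ℤˣ := if f.idx = 3 then 1 else -1

-- Row `f` of `I + A` is supported at the columns `f` and `A⁻¹ f`, and the tetrahedron above `A⁻¹ f`
-- is the one below `f`. The sign `δ` is that of `A⁻¹ f`.
open Classical in
theorem diffMat_row [Finite T] (s : τ.Lift) (f : τ.Face) :
    ∃ δ : ℤˣ, τ.diffMat s f = (((f.sgn : ℤˣ) : ℤ) : τ.GroupRing) • Pi.single f.above 1
      + (((δ : ℤˣ) : ℤ) * τ.mon (s.face f) : τ.GroupRing) • Pi.single f.below 1 := by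
  obtain ⟨f₀, rfl⟩ := τ.abPerm.surjective f
  have hA : τ.abPerm f₀ = τ.abNext f₀ := rfl
  rw [hA]
  set f := τ.abNext f₀ with hf
  have hLAB : ∀ f', τ.matLAB s f f' = (if f = f' then 1 else 0)
      + (if f₀ = f' then 1 else 0) * τ.mon (s.face f) := by
    intro f'
    rw [matLAB, Matrix.add_apply, Matrix.one_apply, Matrix.of_apply]
    by_cases h : f₀ = f'
    · subst h
      simp [← hf]
    · have h' : f ≠ τ.abNext f' := fun h' => h (τ.abNext_injective h')
      simp [h, h']
  have hind : ∀ (f' : τ.Face) (t : T), (if f' = τ.faceEquiv (Sum.inl t) then (1 : τ.GroupRing) else 0)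
      - (if f' = τ.faceEquiv (Sum.inr t) then 1 else 0)
      = ((f'.sgn : ℤ) : τ.GroupRing) * (Pi.single f'.above 1 : T → τ.GroupRing) t := by
    rintro ⟨t', i, rfl | rfl⟩ t <;> by_cases h : t' = t
    · subst h
      simp [faceEquiv, Face.sgn, Face.ext_iff]
    · simp [faceEquiv, Face.sgn, Face.ext_iff, h, Ne.symm h]
    · subst h
      simp [faceEquiv, Face.sgn, Face.ext_iff]
    · simp [faceEquiv, Face.sgn, Face.ext_iff, h, Ne.symm h]
  refine ⟨f₀.sgn, funext fun t => ?_⟩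
  have hb : f.below = f₀.above := τ.below_abNext f₀
  rw [diffMat, Matrix.of_apply, hLAB, hLAB, add_sub_add_comm, ← sub_mul, hind, hind, hb]
  simp only [Pi.add_apply, Pi.smul_apply, smul_eq_mul]
  ring

/-- The element `g` of the group ring, as a unit. -/
noncomputable def monUnit (g : τ.G) : τ.GroupRingˣ where
  val := τ.mon g
  inv := τ.mon (-g)
  val_inv := by rw [← mon_add, add_neg_cancel, mon_zero]
  inv_val := by rw [← mon_add, neg_add_cancel, mon_zero]

theorem monUnit_add (g h : τ.G) : monUnit (g + h) = monUnit g * monUnit h :=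
  Units.ext (τ.mon_add g h)

open Classical in
/-- If all maximal minors of the difference matrix vanish in a quotient of the group ring, then all
elements of `G` become signs in it. -/
theorem exists_map_mon_eq_sign [Fintype T] (s : τ.Lift) {S : Type*} [CommRing S]
    (φ : τ.GroupRing →+* S) (t₀ : T)
    (hφ : ∀ l : T → τ.Face, φ ((τ.diffMat s).submatrix l id).det = 0) (g : τ.G) :
    ∃ ε : ℤˣ, φ (τ.mon g) = ((ε : ℤ) : S) := by
  classical
  let B : Matrix τ.Face T S := (τ.diffMat s).map φ
  have hB : ∀ l : T → τ.Face, (B.submatrix l id).det = 0 := by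
    intro l
    have := hφ l
    rw [RingHom.map_det] at this
    convert this
    rfl
  let sg : ℤˣ →* Sˣ := Units.map (Int.castRingHom S : ℤ →* S)
  let U : τ.G → Sˣ := fun g => Units.map (φ : τ.GroupRing →* S) (monUnit g)
  let e : T → T → S := fun t => Pi.single t 1
  let N : Submodule S (T → S) := Submodule.span S (Set.range fun f => B f)
  have hrow : ∀ f : τ.Face, ∃ α β : ℤˣ,
      sg α • e f.above + (sg β * U (s.face f)) • e f.below ∈ N := by
    intro f
    obtain ⟨δ, hδ⟩ := diffMat_row s f
    refine ⟨f.sgn, δ, ?_⟩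
    have : B f = sg f.sgn • e f.above + (sg δ * U (s.face f)) • e f.below := by
      ext t
      have h1 : B f t = φ (τ.diffMat s f t) := rfl
      rw [h1, hδ]
      simp only [sg, U, e, monUnit, Units.smul_def, Pi.add_apply, Pi.smul_apply, Pi.single_apply]
      split_ifs <;> simp
    rw [← this]
    exact Submodule.subset_span ⟨f, rfl⟩
  have hcomb : ∀ (α β u : Sˣ) (x y z : T → S), α • x + β • y ∈ N → y - u • z ∈ N →
      x - (-(α⁻¹ * β * u)) • z ∈ N := by
    intro α β u x y z h1 h2
    have h3 := N.sub_mem (N.smul_mem ((α⁻¹ : Sˣ) : S) h1)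
      (N.smul_mem ((α⁻¹ * β : Sˣ) : S) h2)
    convert h3 using 1
    ext t
    simp [Units.smul_def]
    ring
  -- Along a path in the dual graph, each row relation expresses a basis vector modulo `N` as a unit
  -- multiple of its neighbour.
  have hpot : ∀ t, ∃ u : Sˣ, e t - u • e t₀ ∈ N := by
    intro t
    induction τ.connected t₀ t with
    | refl => exact ⟨1, by simp⟩
    | tail _ hbc ih =>
      obtain ⟨i, rfl⟩ := hbc
      obtain ⟨u, hu⟩ := ih
      obtain ⟨f, ⟨h1, h2, -⟩ | ⟨h1, h2, -⟩⟩ := τ.exists_face_of_adj _ i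
      · obtain ⟨α, β, h⟩ := hrow f
        rw [h1, h2, add_comm] at h
        exact ⟨_, hcomb _ _ u _ _ _ h hu⟩
      · obtain ⟨α, β, h⟩ := hrow f
        rw [h1, h2] at h
        exact ⟨_, hcomb _ _ u _ _ _ h hu⟩
  choose u hu using hpot
  -- Row `f` gives a second expression of `e f.above` as a multiple of `e t₀`. The two coefficients
  -- agree because the vanishing minors leave `e t₀` no annihilator modulo `N`.
  have hface : ∀ f : τ.Face, ∃ ε : ℤˣ, u f.above = sg ε * (U (s.face f) * u f.below) := by
    intro f
    obtain ⟨α, β, h⟩ := hrow f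
    have h1 := hcomb _ _ _ _ _ _ h (hu f.below)
    have h2 := N.sub_mem h1 (hu f.above)
    have h3 : ((u f.above - (-((sg α)⁻¹ * (sg β * U (s.face f)) * u f.below) : Sˣ) : S)
        • Pi.single t₀ 1 : T → S) ∈ N := by
      convert h2 using 1
      ext t
      simp [Units.smul_def, e]
      ring
    have h4 := eq_zero_of_smul_single_mem N
      (fun M hM => Matrix.det_eq_zero_of_forall_mem_span B hB M hM) t₀ (fun t => u t) hu h3
    refine ⟨-(α⁻¹ * β), Units.ext ?_⟩
    rw [sub_eq_zero.1 h4]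
    simp [sg, mul_assoc]
  -- Modulo signs, `u` is a potential for `U`, so `U` is trivial there.
  let mk : Sˣ →* Sˣ ⧸ sg.range := QuotientGroup.mk' sg.range
  have hmk : ∀ ε x, mk (sg ε * x) = mk x := fun ε x => by
    rw [mul_comm]
    exact QuotientGroup.mk_mul_of_mem x ⟨ε, rfl⟩
  let Φ : τ.G →+ Additive (Sˣ ⧸ sg.range) :=
    AddMonoidHom.mk' (fun g => Additive.ofMul (mk (U g))) fun g h => by
      rw [← ofMul_mul, ← map_mul, ← map_mul, ← monUnit_add]
  have hΦ : Φ = 0 := s.eq_zero_of_potential Φ (fun t => Additive.ofMul (mk (u t))) fun f => by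
    obtain ⟨ε, hε⟩ := hface f
    change Additive.ofMul (mk (u f.above))
      = Additive.ofMul (mk (U (s.face f))) + Additive.ofMul (mk (u f.below))
    rw [hε, hmk, map_mul, ofMul_mul]
  have hg : mk (U g) = 1 := congrArg Additive.toMul (DFunLike.congr_fun hΦ g)
  obtain ⟨ε, hε⟩ := (QuotientGroup.eq_one_iff _).1 hg
  exact ⟨ε, (congrArg Units.val hε).symm⟩

open Classical in
/-- A common divisor of the maximal minors of the difference matrix divides `g ± 1` for all `g`. -/
theorem exists_dvd_mon_sub_sign [Fintype T] (s : τ.Lift) (t₀ : T) {d : τ.GroupRing}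
    (hd : ∀ l : T → τ.Face, d ∣ ((τ.diffMat s).submatrix l id).det) (g : τ.G) :
    ∃ ε : ℤˣ, d ∣ AddMonoidAlgebra.single g 1 - AddMonoidAlgebra.single 0 (ε : ℤ) := by
  obtain ⟨ε, hε⟩ := exists_map_mon_eq_sign s (Ideal.Quotient.mk (Ideal.span {d})) t₀
    (fun l => Ideal.Quotient.eq_zero_iff_mem.2 (Ideal.mem_span_singleton.2 (hd l))) g
  refine ⟨ε, ?_⟩
  rw [← Ideal.mem_span_singleton, ← Ideal.Quotient.eq_zero_iff_mem, map_sub, sub_eq_zero]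
  refine hε.trans ?_
  rw [← map_intCast (Ideal.Quotient.mk (Ideal.span {d}))]
  rfl

end VeeringTriangulation

/-! ### Greatest common divisors and the veering polynomial -/

section GCD

variable {R ι : Type*} [CommRing R] [UniqueFactorizationMonoid R] [Fintype ι]

theorem exists_dvd_iff_forall_dvd (m : ι → R) : ∃ Θ, ∀ d, d ∣ Θ ↔ ∀ i, d ∣ m i := by
  let _ := UniqueFactorizationMonoid.strongNormalizationMonoid (α := R)
  let _ := UniqueFactorizationMonoid.toNormalizedGCDMonoid R
  exact ⟨Finset.univ.gcd m, fun d => by simp [Finset.dvd_gcd_iff]⟩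

theorem dvd_mul_of_forall_dvd_mul {m : ι → R} {Θ : R} (hΘ : ∀ d, d ∣ Θ ↔ ∀ i, d ∣ m i) {v a : R}
    (h : ∀ i, v ∣ a * m i) : v ∣ a * Θ := by
  let _ := UniqueFactorizationMonoid.strongNormalizationMonoid (α := R)
  let _ := UniqueFactorizationMonoid.toNormalizedGCDMonoid R
  have h1 : v ∣ Finset.univ.gcd fun i => a * m i := Finset.dvd_gcd fun i _ => h i
  have h2 : Finset.univ.gcd m ∣ Θ := (hΘ _).2 fun i => Finset.gcd_dvd (Finset.mem_univ i)
  exact (h1.trans (Finset.gcd_mul_left' _ _ a).dvd).trans (mul_dvd_mul_left a h2)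

end GCD

namespace VeeringTriangulation

open ModelTet

variable {T : Type*} {τ : VeeringTriangulation T}

instance [Finite T] : Module.Finite ℤ τ.H1 :=
  have : Module.Finite ℤ (τ.Cell1 →₀ ℤ) := Module.Finite.finsupp
  inferInstance

instance [Finite T] : Module.Free ℤ τ.G := Module.free_of_finite_type_torsion_free'

theorem finrank_G : Module.finrank ℤ τ.G = Module.finrank ℤ τ.H1 :=
  finrank_quotient_eq_of_le_torsion le_rfl

/-- The empty triangulation is vacuously connected; positive rank supplies the base tetrahedron
`t₀`. -/
theorem nonempty_of_finrank_H1_pos (h : 0 < Module.finrank ℤ τ.H1) : Nonempty T := by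
  by_contra hT
  rw [not_nonempty_iff] at hT
  have : IsEmpty τ.Face := ⟨fun f => hT.elim f.above⟩
  have : Subsingleton τ.H1 := inferInstance
  rw [Module.finrank_zero_of_subsingleton] at h
  exact lt_irrefl _ h

theorem eqUpToUnit_of_associated [Finite T] {p q : τ.GroupRing} (h : Associated p q) :
    τ.EqUpToUnit p q := by
  obtain ⟨u, hu⟩ := h.symm
  obtain ⟨ε, g, hg⟩ := AddMonoidAlgebra.eq_single_of_isUnit u.isUnit
  exact ⟨ε, g, by rw [← hu, hg, mul_comm]⟩

open Classical in
theorem isTautPolynomial_iff [Finite T] (s : τ.Lift) (Θ : τ.GroupRing) :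
    τ.IsTautPolynomial s Θ ↔ ∀ d, d ∣ Θ ↔
      ∀ k : τ.Edge → τ.Face, d ∣ ((τ.matLTriangle s).submatrix id k).det := by
  refine forall_congr' fun d => iff_congr Iff.rfl ⟨fun h k => h _ (Ideal.subset_span ⟨k, rfl⟩), ?_⟩
  intro h p hp
  have hle : τ.fittingIdeal s ≤ Ideal.span {d} := by
    refine Ideal.span_le.2 ?_
    rintro _ ⟨k, rfl⟩
    exact Ideal.mem_span_singleton.2 (h k)
  exact Ideal.mem_span_singleton.1 (hle hp)

theorem exists_isTautPolynomial [Finite T] (s : τ.Lift) : ∃ Θ, τ.IsTautPolynomial s Θ := by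
  classical
  have := AddMonoidAlgebra.isDomain_int (G := τ.G)
  have := AddMonoidAlgebra.uniqueFactorizationMonoid_int (G := τ.G)
  simp only [isTautPolynomial_iff]
  exact exists_dvd_iff_forall_dvd _

open Classical in
theorem veeringPolynomial_dvd [Fintype T] (s : τ.Lift) (k : τ.Edge → τ.Face) :
    τ.veeringPolynomial s ∣ τ.abPolynomial s * ((τ.matLTriangle s).submatrix id k).det := by
  by_cases hk : Function.Injective k
  · obtain ⟨σ, hσ⟩ := exists_equiv_comp_inl_eq τ.faceEquiv (hk.comp τ.botEquiv.injective)
    have hk' : σ ∘ Sum.inl ∘ τ.botEquiv.symm = k := by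
      rw [← Function.comp_assoc, hσ, Function.comp_assoc, Equiv.self_comp_symm, Function.comp_id]
    have h := τ.associated_minor_mul_abPolynomial s σ
    rw [hk', mul_comm] at h
    exact h.symm.dvd_iff_dvd_right.1 (dvd_mul_right _ _)
  · obtain ⟨i, j, hij, hne⟩ := Function.not_injective_iff.1 hk
    rw [Matrix.det_zero_of_column_eq hne fun e => by simp [hij], mul_zero]
    exact dvd_zero _

open Classical in
/-- The product of the AB polynomial and the taut polynomial is the product of the veering polynomial
and a common divisor of elements `g ± 1` for all `g` in `G`. -/
theorem exists_abPolynomial_mul_eq [Fintype T] [Nonempty T] (s : τ.Lift) {Θ : τ.GroupRing}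
    (hΘ : τ.IsTautPolynomial s Θ) :
    ∃ c, τ.abPolynomial s * Θ = τ.veeringPolynomial s * c ∧ ∀ g : τ.G, ∃ ε : ℤˣ,
      c ∣ AddMonoidAlgebra.single g 1 - AddMonoidAlgebra.single 0 (ε : ℤ) := by
  have := AddMonoidAlgebra.isDomain_int (G := τ.G)
  have := AddMonoidAlgebra.uniqueFactorizationMonoid_int (G := τ.G)
  rw [isTautPolynomial_iff] at hΘ
  obtain ⟨c, hc⟩ := dvd_mul_of_forall_dvd_mul hΘ (veeringPolynomial_dvd s)
  -- If `V = 0`, then `V^AB · Θ = 0` and `c = 1` serves. Otherwise `V · c = V^AB · Θ` divides `V^AB`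
  -- times each minor of `L^△`, an associate of `V` times the complementary minor of `diffMat`, and
  -- `V` cancels.
  by_cases hV : τ.veeringPolynomial s = 0
  · refine ⟨1, by rw [hc, hV, zero_mul, zero_mul], fun g => ⟨1, one_dvd _⟩⟩
  · refine ⟨c, hc, exists_dvd_mon_sub_sign s (Classical.arbitrary T) fun l => ?_⟩
    by_cases hl : Function.Injective l
    · obtain ⟨σ, rfl⟩ := exists_equiv_comp_inr_eq τ.faceEquiv hl
      have h := τ.associated_minor_mul_abPolynomial s σ
      refine (mul_dvd_mul_iff_left hV).1 (h.dvd_iff_dvd_right.1 ?_)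
      rw [← hc, mul_comm]
      exact mul_dvd_mul ((hΘ Θ).1 dvd_rfl _) dvd_rfl
    · obtain ⟨i, j, hij, hne⟩ := Function.not_injective_iff.1 hl
      rw [Matrix.det_zero_of_row_eq hne (by ext t; simp [hij])]
      exact dvd_zero _

end VeeringTriangulation

theorem theorem6p2 {T : Type*} [Fintype T] (τ : VeeringTriangulation T) (s : τ.Lift) :
    (∃ Θ, τ.IsTautPolynomial s Θ) ∧
    τ.EqUpToUnit (τ.abPolynomial s)
      (∏ c : τ.ABCycle, (1 + (-1) ^ (τ.abLength c + 1) * τ.mon (τ.abClass c))) ∧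
    (1 < Module.finrank ℤ τ.H1 → ∀ Θ, τ.IsTautPolynomial s Θ →
      τ.EqUpToUnit (τ.veeringPolynomial s) (τ.abPolynomial s * Θ)) ∧
    (Module.finrank ℤ τ.H1 = 1 → ∀ t : τ.G, AddSubgroup.zmultiples t = ⊤ →
      ∀ Θ, τ.IsTautPolynomial s Θ →
        τ.EqUpToUnit (τ.veeringPolynomial s) (τ.abPolynomial s * Θ) ∨
        τ.EqUpToUnit (τ.veeringPolynomial s * (1 + τ.mon t)) (τ.abPolynomial s * Θ) ∨
        τ.EqUpToUnit (τ.veeringPolynomial s * (1 - τ.mon t)) (τ.abPolynomial s * Θ)) := by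
  refine ⟨VeeringTriangulation.exists_isTautPolynomial s,
    VeeringTriangulation.eqUpToUnit_of_associated (.of_eq (τ.abPolynomial_eq_prod s)),
    fun hrank Θ hΘ => ?_, fun hrank t ht Θ hΘ => ?_⟩
  · have := VeeringTriangulation.nonempty_of_finrank_H1_pos (zero_lt_one.trans hrank)
    obtain ⟨c, hc, hdvd⟩ := VeeringTriangulation.exists_abPolynomial_mul_eq s hΘ
    rw [← VeeringTriangulation.finrank_G] at hrank
    rw [hc]
    exact VeeringTriangulation.eqUpToUnit_of_associated
      (associated_mul_unit_right _ _ (AddMonoidAlgebra.isUnit_of_forall_dvd hrank hdvd))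
  · have hpos : 0 < Module.finrank ℤ τ.H1 := by omega
    have := VeeringTriangulation.nonempty_of_finrank_H1_pos hpos
    obtain ⟨c, hc, hdvd⟩ := VeeringTriangulation.exists_abPolynomial_mul_eq s hΘ
    rw [← VeeringTriangulation.finrank_G] at hpos
    obtain ⟨a, ha⟩ := exists_addMonoidHom_eq_one hpos ht
    obtain ⟨ε, hε⟩ := hdvd t
    rw [hc]
    rcases AddMonoidAlgebra.isUnit_or_associated_of_dvd ε ha hε with hu | hassoc
    · exact Or.inl (VeeringTriangulation.eqUpToUnit_of_associated
        (associated_mul_unit_right _ _ hu))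
    · right
      -- The sign `ε = 1` gives the factor `1 - t`, and `ε = -1` gives `1 + t`.
      rcases Int.units_eq_one_or ε with rfl | rfl
      · right
        refine VeeringTriangulation.eqUpToUnit_of_associated (Associated.mul_left _ ?_)
        have h : (AddMonoidAlgebra.single t 1 - AddMonoidAlgebra.single 0 ((1 : ℤˣ) : ℤ) :
            τ.GroupRing) = -(1 - τ.mon t) := by
          rw [neg_sub]
          rfl
        rw [h] at hassoc
        exact (Associated.neg_right_iff.1 hassoc).symm
      · left
        refine VeeringTriangulation.eqUpToUnit_of_associated (Associated.mul_left _ ?_)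
        have h : (AddMonoidAlgebra.single t 1 - AddMonoidAlgebra.single 0 ((-1 : ℤˣ) : ℤ) :
            τ.GroupRing) = 1 + τ.mon t := by
          rw [Units.val_neg, Units.val_one, AddMonoidAlgebra.single_neg, sub_neg_eq_add, add_comm]
          rfl
        rw [h] at hassoc
        exact hassoc.symm
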